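/- **Setting.** A *shaded brickwork circuit* is a finite planar diagram on sites $0,\dots,n$ (wires) whose four-valent vertices occupy positions of the brickwork pattern: at a given layer a vertex joins two neighbouring sites $i,i+1$, all vertices of one layer have the same parity of $i$, and consecutive layers are shifted by one site; each layer is one time step. The diagram may be any finite piece of the pattern; wires and regions that meet no vertex in a layer run straight through it. Each region of the diagram is shaded or unshaded. A region carries a finite nonempty index set, which is a one-point set if the region is unshaded; a wire carries a finite-dimensional Hilbert space $\mathbb C^{d}$, $d\ge 1$, with $d=1$ if the wire borders a shaded region. Dimensions may vary from region to region and from wire to wire. A vertex with regions $l,r,a,b$ to its left, right, above and below is an array of complex numbers $U^{\,l,r,a,b}_{p_1p_2,q_1q_2}$, where $p_1,p_2$ index the upper left and upper right wires and $q_1,q_2$ the lower left and lower right wires. It is *biunitary* if * (vertical unitarity) for all $l,r$ the matrix with rows $(a,p_1,p_2)$ and columns $(b,q_1,q_2)$ is unitary, and * (horizontal unitarity) there is a constant $\lambda>0$ such that for all $a,b$ the matrix $N$ with rows $(l,p_1,q_1)$ and columns $(r,p_2,q_2)$ satisfies $NN^\dagger=\lambda\mathbb 1$ and $N^\dagger N=\lambda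 \mathbb 1$. Depending on which of the four regions are shaded, biunitaries are dual-unitary gates (none shaded), unitary error bases (one), Hadamard matrices (two opposite), quantum Latin squares (two adjacent) or quantum crosses (all four), up to normalization. A *biunitary circuit* is a shaded brickwork circuit all of whose vertices are biunitary; arbitrary shadings may be mixed. The Hilbert space of a time slice has as basis the joint labellings of all regions and wires of that slice. A layer acts as the product of its vertices, with the identity on all regions and wires that meet no vertex of the layer; $\mathcal U_t$ is the resulting operator of the first $t$ layers, from the initial slice to slice $t$. Fix an origin $o$, give site $o+x$ the coordinate $x$, and let $\rho(x)=\mathbb 1\otimes\cdots\otimes\rho\otimes\cdots\otimes\mathbb 1$ denote an operator $\rho$ acting on the wire at coordinate $x$. For an operator $\rho$ on the wire at coordinate $0$ of slice $t$ and an operator $\sigma$ on the wire at coordinate $x$ of the initial slice, let $$c_{\rho\sigma}(x,t)=\frac{\operatorname{Tr}\big[\mathcal U_t^\dagger\,\rho(0)\,\mathcal U_t\,\sigma(x)\big]}{\operatorname{Tr}[\mathbb 1]} .$$ **Theorem.** Consider a biunitary circuit and $t\in\mathbb N$ such that the backward light cone of site $0$ at time $t$ lies inside the circuit: the sites with coordinates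 $-t,\dots,t$ belong to the chain, and no brickwork position of the first $t$ layers inside that cone lacks its vertex. Let $\rho,\sigma$ be traceless operators as above. Then for every site $x$ of the chain, $$c_{\rho\sigma}(x,t)=0\qquad\text{unless } |x|=t \text{ or } |x|=t-1 .$$ -/

import Mathlib

open scoped Matrix

noncomputable section

/-- A four-valent vertex of the shaded calculus.  Its value is indexed by the labels of the
regions to its left (`dl` labels), right (`dr`), above (`dt`) and below (`db`), and by the labels of
its top left, top right, bottom left and bottom right wires (`tl`, `tr`, `bl`, `br`).  An unshaded
region has one label, and so has a wire that borders a shaded region. -/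
abbrev ShadedVertex (dl dr dt db tl tr bl br : ℕ) : Type :=
  Fin dl → Fin dr → Fin dt → Fin db → Fin tl → Fin tr → Fin bl → Fin br → ℂ

namespace ShadedVertex

variable {dl dr dt db tl tr bl br : ℕ}

/-- The vertex read from bottom to top.  The left and right regions are open on both sides of any
vertical composite, so their labels are parameters. -/
def vertical (U : ShadedVertex dl dr dt db tl tr bl br) (l : Fin dl) (r : Fin dr) :
    Matrix (Fin dt × Fin tl × Fin tr) (Fin db × Fin bl × Fin br) ℂ :=
  fun p q => U l r p.1 q.1 p.2.1 p.2.2 q.2.1 q.2.2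

/-- The vertex read sideways: rows are its left region and its two left wires, columns its right
region and its two right wires; the labels of the top and bottom regions are parameters. -/
def horizontal (U : ShadedVertex dl dr dt db tl tr bl br) (t : Fin dt) (b : Fin db) :
    Matrix (Fin dl × Fin tl × Fin bl) (Fin dr × Fin tr × Fin br) ℂ :=
  fun p q => U p.1 q.1 t b p.2.1 q.2.1 p.2.2 q.2.2

/-- Biunitarity: (vertical) unitarity, and horizontal unitarity up to one constant.
With no shaded region this is a dual-unitary gate, with one a unitary error basis, with two
opposite ones a Hadamard matrix, with two adjacent ones a quantum Latin square and with four a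
quantum cross (each in the normalization in which it is vertically unitary). -/
def IsBiunitary (U : ShadedVertex dl dr dt db tl tr bl br) : Prop :=
  (∀ l r, U.vertical l r * (U.vertical l r)ᴴ = 1 ∧ (U.vertical l r)ᴴ * U.vertical l r = 1) ∧
  ∃ c : ℝ, 0 < c ∧ ∀ t b,
    U.horizontal t b * (U.horizontal t b)ᴴ = (c : ℂ) • 1 ∧
    (U.horizontal t b)ᴴ * U.horizontal t b = (c : ℂ) • 1

end ShadedVertex

/-- A finite shaded brickwork circuit on `n + 1` sites `0, …, n`.

Time slices are numbered `0, 1, 2, …`, and layer `s` (one time step) lies between the slices `s` and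
`s + 1`.  On every slice, site `x` is a wire and there are `n + 2` regions; site `x` lies between
region `x` (= `x.castSucc`) and region `x + 1` (= `x.succ`), so that the regions `0` and `n + 1` are
the exterior of the chain.  A vertex at position `i : Fin n` acts on the sites `i` and `i + 1`; it
has region `i` on its left, region `i + 2` on its right, and region `i + 1` above and below it.
Two neighbouring layers are shifted against each other by one site.

The diagram may be any finite piece of the brickwork pattern: a position of the pattern need not
carry a vertex, and wires and regions that meet no vertex in a layer run straight through it.  -/
structure ShadedCircuit (n : ℕ) where
  /-- which of the two sublattices of positions layer `0` uses -/
  offset : ℕ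
  /-- is there a vertex at position `i` of layer `s`? -/
  vertex : Fin n → ℕ → Prop
  brickwork : ∀ i s, vertex i s → Even ((i : ℕ) + s + offset)
  /-- is the `k`-th region on slice `s` shaded? -/
  shaded : Fin (n + 2) → ℕ → Prop
  /-- number of labels of the `k`-th region on slice `s` -/
  regionDim : Fin (n + 2) → ℕ → ℕ
  /-- number of labels of (dimension of) the wire at site `x` on slice `s` -/
  wireDim : Fin (n + 1) → ℕ → ℕ
  regionDim_pos : ∀ k s, 0 < regionDim k s
  wireDim_pos : ∀ x s, 0 < wireDim x s
  regionDim_unshaded : ∀ k s, ¬ shaded k s → regionDim k s = 1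
  /-- only bare wires carry an index -/
  wireDim_shaded : ∀ x s, shaded x.castSucc s ∨ shaded x.succ s → wireDim x s = 1
  /-- without a vertex in between, it is one and the same region -/
  shaded_straight : ∀ k s, (∀ i, vertex i s → i.succ.castSucc ≠ k) →
    (shaded k (s + 1) ↔ shaded k s)
  regionDim_straight : ∀ k s, (∀ i, vertex i s → i.succ.castSucc ≠ k) →
    regionDim k (s + 1) = regionDim k s
  /-- without a vertex in between, it is one and the same wire -/
  wireDim_straight : ∀ x s, (∀ i, vertex i s → i.castSucc ≠ x ∧ i.succ ≠ x) →
    wireDim x (s + 1) = wireDim x s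
  /-- the vertices (the value is irrelevant where there is no vertex) -/
  tensor : ∀ (i : Fin n) (s : ℕ),
    ShadedVertex (regionDim i.castSucc.castSucc s) (regionDim i.succ.succ s)
      (regionDim i.succ.castSucc (s + 1)) (regionDim i.succ.castSucc s)
      (wireDim i.castSucc (s + 1)) (wireDim i.succ (s + 1))
      (wireDim i.castSucc s) (wireDim i.succ s)

namespace ShadedCircuit

variable {n : ℕ} (C : ShadedCircuit n)

/-- A biunitary circuit: every vertex is biunitary. -/
def IsBiunitary : Prop := ∀ i s, C.vertex i s → (C.tensor i s).IsBiunitary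

/-- The labels of all regions and wires on a slice.  They are the basis of the Hilbert space of that
slice. -/
abbrev Config (s : ℕ) : Type :=
  (∀ k : Fin (n + 2), Fin (C.regionDim k s)) × (∀ x : Fin (n + 1), Fin (C.wireDim x s))

/-- All regions and wires that meet no vertex in layer `s` have the same label before (`z`) and
after (`y`) that layer. -/
def Straight (s : ℕ) (y : C.Config (s + 1)) (z : C.Config s) : Prop :=
  (∀ k, (∀ i, C.vertex i s → i.succ.castSucc ≠ k) → (y.1 k : ℕ) = z.1 k) ∧
  (∀ x, (∀ i, C.vertex i s → i.castSucc ≠ x ∧ i.succ ≠ x) → (y.2 x : ℕ) = z.2 x)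

open Classical in
/-- The operator of layer `s`, from the Hilbert space of slice `s` to that of slice `s + 1`. -/
def layer (s : ℕ) : Matrix (C.Config (s + 1)) (C.Config s) ℂ := fun y z =>
  if C.Straight s y z then
    ∏ i : Fin n, if C.vertex i s then
      C.tensor i s (z.1 i.castSucc.castSucc) (z.1 i.succ.succ)
        (y.1 i.succ.castSucc) (z.1 i.succ.castSucc)
        (y.2 i.castSucc) (y.2 i.succ) (z.2 i.castSucc) (z.2 i.succ)
    else 1
  else 0

/-- The operator `𝒰_t` of the first `t` layers. -/
def evolution : (t : ℕ) → Matrix (C.Config t) (C.Config 0) ℂ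
  | 0 => 1
  | t + 1 => C.layer t * evolution t

open Classical in
/-- The operator `1 ⊗ ⋯ ⊗ 1 ⊗ ρ ⊗ 1 ⊗ ⋯ ⊗ 1` on slice `s`, with `ρ` acting on the wire at
site `x`. -/
def siteOp {s : ℕ} (x : Fin (n + 1))
    (ρ : Matrix (Fin (C.wireDim x s)) (Fin (C.wireDim x s)) ℂ) :
    Matrix (C.Config s) (C.Config s) ℂ := fun y z =>
  if y.1 = z.1 ∧ ∀ x', x' ≠ x → y.2 x' = z.2 x' then ρ (y.2 x) (z.2 x) else 0

/-- The infinite-temperature correlation function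
`Tr[𝒰_t† ρ(o) 𝒰_t σ(j)] / Tr[1]`. -/
def correlation (t : ℕ) (o j : Fin (n + 1))
    (ρ : Matrix (Fin (C.wireDim o t)) (Fin (C.wireDim o t)) ℂ)
    (σ : Matrix (Fin (C.wireDim j 0)) (Fin (C.wireDim j 0)) ℂ) : ℂ :=
  ((C.evolution t)ᴴ * C.siteOp o ρ * C.evolution t * C.siteOp j σ).trace /
    (1 : Matrix (C.Config 0) (C.Config 0) ℂ).trace

/-- The chain and the diagram contain the backward light cone of site `o` on slice `t`: the sites at
distance at most `t` from `o` belong to the chain, and no vertex of the brickwork pattern is missing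
in the cone.  (In layer `s`, the cone has the positions of the pattern between `o - (t - s)` and
`o + (t - s) - 1`.) -/
def ContainsLightCone (o : Fin (n + 1)) (t : ℕ) : Prop :=
  t ≤ (o : ℕ) ∧ (o : ℕ) + t ≤ n ∧
  ∀ s, s < t → ∀ i : Fin n, Even ((i : ℕ) + s + C.offset) →
    (o : ℕ) ≤ i + (t - s) → (i : ℕ) < o + (t - s) → C.vertex i s

end ShadedCircuit

end

/-! The mechanism is that of dual-unitary circuits. By the brickwork parity, the wire at `o` on
slice `t` is either the upper right or the upper left leg of the pattern position below it. Take the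
first case. Going down from `o`, the positions `o - t + s` in layers `s < t` form a light ray that
ends at site `o - t` on slice 0. If `σ` sits to the left of that endpoint, vertical unitarity
suffices: the backward evolved `ρ` is the identity there, and the trace of `σ` factors out. If `σ`
sits to the right, it is evolved forward instead. The trace is insensitive to labels on which the
backward evolved `ρ` acts as the identity, so they may be averaged over; horizontal unitarity of the
vertex on the ray then collapses that vertex, and what remains of the evolved `σ` is the identity on
one more wire. At slice `t` this wire is `o`, and the trace of `ρ` factors out. So in this case only
`x = -t` survives; the other parity is the mirror image and leaves only `x = t`.

With shaded regions, vertices are controlled by the labels of their left and right regions, so an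
evolved operator can be the identity on wires and yet depend on an adjacent region label, though
diagonally. Hence two sets are tracked in `IsLocal J D`: identity on `J`, merely diagonal on `D`,
where `D` exceeds `J` by the one region at the front. The two halves of the argument are
`IsFrontLayer.isLocal` (backward, vertical unitarity) and `exists_trace_mul_conj_eq` (forward,
horizontal unitarity), iterated along the ray in `IsLightFront`. -/

noncomputable section

/-- Joint labellings of the indices in `I`, the index `i` having the labels `0, …, d i - 1`. -/
abbrev Labelling {I : Type*} (d : I → ℕ) : Type _ := {f : I → ℕ // ∀ i, f i < d i}

/-! ### Operators that are the identity on `J` and diagonal on `D` -/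

namespace Labelling

variable {I : Type*} {d : I → ℕ}

def equivPi (d : I → ℕ) : Labelling d ≃ ∀ i, Fin (d i) where
  toFun f i := ⟨f.1 i, f.2 i⟩
  invFun f := ⟨fun i => f i, fun i => (f i).2⟩
  left_inv _ := rfl
  right_inv _ := rfl

instance [Fintype I] [DecidableEq I] : Fintype (Labelling d) :=
  Fintype.ofEquiv _ (equivPi d).symm

/-- An operator that is diagonal in the labels in `D` and acts as the identity on the indices
in `J`. -/
structure IsLocal (J D : Set I) (M : Matrix (Labelling d) (Labelling d) ℂ) : Prop where
  diag : ∀ f g i, i ∈ D → f.1 i ≠ g.1 i → M f g = 0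
  indep : ∀ f g f' g', (∀ i, i ∉ J → f.1 i = f'.1 i) → (∀ i, i ∉ J → g.1 i = g'.1 i) →
    (∀ i, i ∈ J → f.1 i = g.1 i) → (∀ i, i ∈ J → f'.1 i = g'.1 i) → M f g = M f' g'

/-- With `J ⊆ D` both entries vanish as soon as the labels differ somewhere on `J`, so `indep`
extends to all pairs with the same pattern of agreement on `J`. -/
theorem IsLocal.congr {J D : Set I} (hJD : J ⊆ D) {M : Matrix (Labelling d) (Labelling d) ℂ}
    (hM : IsLocal J D M) {f g f' g' : Labelling d} (hf : ∀ i, i ∉ J → f.1 i = f'.1 i)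
    (hg : ∀ i, i ∉ J → g.1 i = g'.1 i)
    (h : ∀ i, i ∈ J → (f.1 i = g.1 i ↔ f'.1 i = g'.1 i)) : M f g = M f' g' := by
  by_cases hfg : ∀ i ∈ J, f.1 i = g.1 i
  · exact hM.indep _ _ _ _ hf hg hfg fun i hi => (h i hi).1 (hfg i hi)
  · push Not at hfg
    obtain ⟨i, hi, hne⟩ := hfg
    rw [hM.diag f g i (hJD hi) hne, hM.diag f' g' i (hJD hi) fun e => hne ((h i hi).2 e)]

theorem IsLocal.mono {J D J' D' : Set I} (hJD : J ⊆ D) {M : Matrix (Labelling d) (Labelling d) ℂ}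
    (hM : IsLocal J D M) (hJ : J' ⊆ J) (hD : D' ⊆ D) : IsLocal J' D' M where
  diag f g i hi h := hM.diag f g i (hD hi) h
  indep f g f' g' hf hg h h' := by
    refine hM.congr hJD (fun i hi => hf i fun h => hi (hJ h)) (fun i hi => hg i fun h => hi (hJ h))
      fun i _ => ?_
    by_cases hi : i ∈ J'
    · simp [h i hi, h' i hi]
    · rw [hf i hi, hg i hi]

/-- Entries of `M` facing a zero of `A` are irrelevant; diagonality of `A` is exploited through
this. -/
theorem trace_mul_congr {α : Type*} [Fintype α] {A M M' : Matrix α α ℂ}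
    (h : ∀ f f', A f f' * M f' f = A f f' * M' f' f) : (A * M).trace = (A * M').trace := by
  simp only [Matrix.trace, Matrix.diag, Matrix.mul_apply]
  exact Finset.sum_congr rfl fun f _ => Finset.sum_congr rfl fun f' _ => h f f'

/-- Averaging over a variable `π f` (which can be set to `x` by `φ x`) on which `A` acts as the
identity does not change a trace against `A`. -/
theorem trace_mul_average {α X : Type*} [Fintype α] [Fintype X] [DecidableEq X] (φ : X → α → α)
    (π : α → X) (h1 : ∀ f, φ (π f) f = f) (h2 : ∀ x f, π (φ x f) = x)
    (h3 : ∀ x y f, φ x (φ y f) = φ x f) (A M : Matrix α α ℂ)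
    (hA : ∀ f g, π f ≠ π g → A f g = 0) (hA' : ∀ x f g, π f = π g → A (φ x f) (φ x g) = A f g) :
    (Fintype.card X : ℂ) * (A * M).trace =
      (A * Matrix.of fun f g => if π f = π g then ∑ x, M (φ x f) (φ x g) else 0).trace := by
  -- The left side sums over triples `(x, f, g)`. Where `π f = π g`, this involution exchanges `x`
  -- with that common value; `A` does not notice, and `x` moves into `M`.
  let e : Equiv.Perm (X × α × α) := Function.Involutive.toPerm
    (fun z => if π z.2.1 = π z.2.2 then (π z.2.1, φ z.1 z.2.1, φ z.1 z.2.2) else z) (by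
      rintro ⟨x, f, g⟩
      by_cases h : π f = π g
      · simp only [h, if_true, h2, h3, h1]
        rw [← h, h1]
      · simp [h])
  have key := Equiv.sum_comp e (fun z : X × α × α => A z.2.1 z.2.2 *
    if π z.2.2 = π z.2.1 then M (φ z.1 z.2.2) (φ z.1 z.2.1) else 0)
  have lhs : ∀ z : X × α × α, A (e z).2.1 (e z).2.2 *
      (if π (e z).2.2 = π (e z).2.1 then M (φ (e z).1 (e z).2.2) (φ (e z).1 (e z).2.1) else 0) =
      A z.2.1 z.2.2 * M z.2.2 z.2.1 := by
    rintro ⟨x, f, g⟩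
    by_cases h : π f = π g
    · have : e (x, f, g) = (π f, φ x f, φ x g) := if_pos h
      rw [this]
      simp only [h2, if_true, h3, h1, hA' x f g h]
      rw [h, h1]
    · have : e (x, f, g) = (x, f, g) := if_neg h
      rw [this]
      simp [hA f g h]
  rw [Finset.sum_congr rfl fun z _ => lhs z] at key
  simp only [Fintype.sum_prod_type] at key
  simp only [Matrix.trace, Matrix.diag, Matrix.mul_apply, Matrix.of_apply]
  rw [Finset.sum_const, Finset.card_univ, nsmul_eq_mul] at key
  rw [key, Finset.sum_comm]
  refine Finset.sum_congr rfl fun f _ => ?_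
  rw [Finset.sum_comm]
  refine Finset.sum_congr rfl fun g _ => ?_
  rw [← Finset.mul_sum]
  congr 1
  split_ifs <;> simp

def update [DecidableEq I] (f : Labelling d) (i : I) (a : Fin (d i)) : Labelling d :=
  ⟨Function.update f.1 i a, fun j => by
    by_cases h : j = i
    · subst h; simp
    · simpa [h] using f.2 j⟩

open Classical in
/-- The operator that acts as `ρ` on the index `i` and as the identity elsewhere. -/
def siteOp (d : I → ℕ) (i : I) (ρ : Matrix (Fin (d i)) (Fin (d i)) ℂ) :
    Matrix (Labelling d) (Labelling d) ℂ := Matrix.of fun f g =>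
  if ∀ j, j ≠ i → f.1 j = g.1 j then ρ ⟨f.1 i, f.2 i⟩ ⟨g.1 i, g.2 i⟩ else 0

open Classical in
theorem siteOp_apply (i : I) (ρ : Matrix (Fin (d i)) (Fin (d i)) ℂ) (f g : Labelling d) :
    siteOp d i ρ f g = if ∀ j, j ≠ i → f.1 j = g.1 j then ρ ⟨f.1 i, f.2 i⟩ ⟨g.1 i, g.2 i⟩ else 0 :=
  rfl

theorem isLocal_siteOp (i : I) (ρ : Matrix (Fin (d i)) (Fin (d i)) ℂ) {J D : Set I}
    (hJD : J ⊆ D) (hi : i ∉ D) : IsLocal J D (siteOp d i ρ) where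
  diag f g j hj h := by
    rw [siteOp_apply, if_neg]
    exact fun H => h (H j fun e => hi (e ▸ hj))
  indep f g f' g' hf hg h h' := by
    have hiJ : i ∉ J := fun h => hi (hJD h)
    have e1 : (⟨f.1 i, f.2 i⟩ : Fin (d i)) = ⟨f'.1 i, f'.2 i⟩ := Fin.ext (hf i hiJ)
    have e2 : (⟨g.1 i, g.2 i⟩ : Fin (d i)) = ⟨g'.1 i, g'.2 i⟩ := Fin.ext (hg i hiJ)
    have : (∀ j, j ≠ i → f.1 j = g.1 j) ↔ (∀ j, j ≠ i → f'.1 j = g'.1 j) := by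
      refine forall_congr' fun j => imp_congr_right fun _ => ?_
      by_cases hj : j ∈ J
      · simp [h j hj, h' j hj]
      · rw [hf j hj, hg j hj]
    simp only [siteOp_apply, e1, e2]
    classical exact if_congr this rfl rfl

/-- Averaging over the label at `i`, which `A` does not see, replaces `ρ` by its trace. -/
theorem trace_mul_siteOp [Fintype I] [DecidableEq I] (hd : ∀ i, 0 < d i) (i : I)
    (ρ : Matrix (Fin (d i)) (Fin (d i)) ℂ)
    (hρ : ρ.trace = 0) {J D : Set I} (hJD : J ⊆ D) (hi : i ∈ J)
    {A : Matrix (Labelling d) (Labelling d) ℂ} (hA : IsLocal J D A) :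
    (A * siteOp d i ρ).trace = 0 := by
  have key := trace_mul_average (fun (x : Fin (d i)) (f : Labelling d) => update f i x)
    (fun f => ⟨f.1 i, f.2 i⟩) (fun f => by ext; simp [update])
    (fun x f => by simp [update]) (fun x y f => by simp [update]) A (siteOp d i ρ)
    (fun f g h => hA.diag f g i (hJD hi) fun e => h (Fin.ext e))
    (fun x f g h => hA.congr hJD
      (fun j hj => by
        have : j ≠ i := fun e => hj (e ▸ hi)
        simp [update, this])
      (fun j hj => by
        have : j ≠ i := fun e => hj (e ▸ hi)
        simp [update, this])
      (fun j _ => by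
        by_cases hj : j = i
        · subst hj; simpa [update] using h
        · simp [update, hj]))
  have hc : (Fintype.card (Fin (d i)) : ℂ) ≠ 0 := by simpa using (hd i).ne'
  refine (mul_eq_zero.1 (key.trans ?_)).resolve_left hc
  convert Matrix.trace_zero (n := Labelling d) (R := ℂ)
  convert Matrix.mul_zero A
  ext f g
  simp only [Matrix.of_apply, Matrix.zero_apply, ite_eq_right_iff]
  intro _
  by_cases h : ∀ j, j ≠ i → f.1 j = g.1 j
  · refine Eq.trans (Finset.sum_congr rfl fun x _ => ?_) hρ
    rw [siteOp_apply, if_pos]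
    · simp [update]
    · intro j hj; simpa [update, hj] using h j hj
  · refine Finset.sum_eq_zero fun x _ => ?_
    rw [siteOp_apply, if_neg]
    intro H; apply h; intro j hj; simpa [update, hj] using H j hj

end Labelling

/-! ### A single gate and vertical unitarity -/

open Labelling

/-- A gate that changes the labels of `m` (a region) and `p`, `q` (wires), and is controlled by the
labels of `l` and `r` (the regions next to `p` and to `q`). -/
structure Gate (I : Type*) where
  (m p q l r : I)
  /-- arguments: `l`, `r`, `m` after, `m` before, `p` after, `q` after, `p` before, `q` before -/
  amp : ℕ → ℕ → ℕ → ℕ → ℕ → ℕ → ℕ → ℕ → ℂ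
  hmp : m ≠ p
  hmq : m ≠ q
  hpq : p ≠ q
  hlr : l ≠ r
  hlm : l ≠ m
  hlp : l ≠ p
  hlq : l ≠ q
  hrm : r ≠ m
  hrp : r ≠ p
  hrq : r ≠ q

namespace Gate

variable {I : Type*} (g : Gate I)

/-- The gate with left and right exchanged. -/
def mirror : Gate I where
  m := g.m
  p := g.q
  q := g.p
  l := g.r
  r := g.l
  amp l r a b p₁ p₂ q₁ q₂ := g.amp r l a b p₂ p₁ q₂ q₁
  hmp := g.hmq
  hmq := g.hmp
  hpq := g.hpq.symm
  hlr := g.hlr.symm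
  hlm := g.hrm
  hlp := g.hrq
  hlq := g.hrp
  hrm := g.hlm
  hrp := g.hlq
  hrq := g.hlp

/-- The adjoint gate. -/
def adjoint : Gate I where
  __ := g
  amp l r a b p₁ p₂ q₁ q₂ := star (g.amp l r b a q₁ q₂ p₁ p₂)

/-- The indices that the gate changes. -/
def target : Set I := {g.m, g.p, g.q}

theorem mem_target {i : I} : i ∈ g.target ↔ i = g.m ∨ i = g.p ∨ i = g.q := Iff.rfl

/-- The matrix element between the labellings `f` (before) and `h` (after). -/
def elem (h f : I → ℕ) : ℂ :=
  g.amp (f g.l) (f g.r) (h g.m) (f g.m) (h g.p) (h g.q) (f g.p) (f g.q)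

/-- The rows of the gate are orthonormal, so that its adjoint is an isometry. -/
def IsCoisometry (d d' : I → ℕ) : Prop :=
  ∀ l < d g.l, ∀ r < d g.r, ∀ a < d' g.m, ∀ a' < d' g.m, ∀ p₁ < d' g.p, ∀ p₁' < d' g.p,
    ∀ p₂ < d' g.q, ∀ p₂' < d' g.q,
    ∑ b : Fin (d g.m), ∑ q₁ : Fin (d g.p), ∑ q₂ : Fin (d g.q),
      g.amp l r a b p₁ p₂ q₁ q₂ * star (g.amp l r a' b p₁' p₂' q₁ q₂) =
      if a = a' ∧ p₁ = p₁' ∧ p₂ = p₂' then 1 else 0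

/-- The gate read from right to left is proportional to an isometry. -/
def IsHorizontalIsometry (d d' : I → ℕ) (c : ℂ) : Prop :=
  ∀ a < d' g.m, ∀ b < d g.m, ∀ r < d g.r, ∀ r' < d g.r, ∀ p₂ < d' g.q, ∀ p₂' < d' g.q,
    ∀ q₂ < d g.q, ∀ q₂' < d g.q,
    ∑ l : Fin (d g.l), ∑ p₁ : Fin (d' g.p), ∑ q₁ : Fin (d g.p),
      g.amp l r a b p₁ p₂ q₁ q₂ * star (g.amp l r' a b p₁ p₂' q₁ q₂') =
      if r = r' ∧ p₂ = p₂' ∧ q₂ = q₂' then c else 0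

/-- Only the dimensions of the targets of the gate change. -/
def Compat (d d' : I → ℕ) : Prop := ∀ i, i ∉ g.target → d i = d' i

theorem Compat.adjoint {g : Gate I} {d d' : I → ℕ} (h : g.Compat d d') :
    g.adjoint.Compat d' d := fun i hi => (h i hi).symm

open Classical in
def mat (d d' : I → ℕ) : Matrix (Labelling d') (Labelling d) ℂ := Matrix.of fun h f =>
  if ∀ i, i ∉ g.target → h.1 i = f.1 i then g.elem h.1 f.1 else 0

open Classical in
theorem mat_apply (d d' : I → ℕ) (h : Labelling d') (f : Labelling d) : g.mat d d' h f =
    if ∀ i, i ∉ g.target → h.1 i = f.1 i then g.elem h.1 f.1 else 0 := rfl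

theorem l_notMem : g.l ∉ g.target := by simp [mem_target, g.hlm, g.hlp, g.hlq]

theorem r_notMem : g.r ∉ g.target := by simp [mem_target, g.hrm, g.hrp, g.hrq]

theorem elem_adjoint {h f : I → ℕ} (hl : h g.l = f g.l) (hr : h g.r = f g.r) :
    g.adjoint.elem f h = star (g.elem h f) := by
  simp only [elem, adjoint, hl, hr]

theorem mat_conjTranspose (d d' : I → ℕ) : (g.mat d d')ᴴ = g.adjoint.mat d' d := by
  ext f h
  simp only [mat, Matrix.conjTranspose_apply, Matrix.of_apply]
  by_cases H : ∀ i, i ∉ g.target → h.1 i = f.1 i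
  · rw [if_pos H, ← elem_adjoint g (H _ g.l_notMem) (H _ g.r_notMem)]
    exact (if_pos (fun i hi => (H i hi).symm)).symm
  · rw [if_neg H, star_zero]
    exact (if_neg fun H' => H fun i hi => (H' i hi).symm).symm

variable [DecidableEq I]

/-- The labelling `f` with new labels on the targets of the gate. -/
def putFun (f : I → ℕ) (x : ℕ × ℕ × ℕ) (i : I) : ℕ :=
  if i = g.m then x.1 else if i = g.p then x.2.1 else if i = g.q then x.2.2 else f i

@[simp] theorem putFun_m (f : I → ℕ) (x : ℕ × ℕ × ℕ) : g.putFun f x g.m = x.1 := by simp [putFun]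
@[simp] theorem putFun_p (f : I → ℕ) (x : ℕ × ℕ × ℕ) : g.putFun f x g.p = x.2.1 := by
  simp [putFun, g.hmp.symm]
@[simp] theorem putFun_q (f : I → ℕ) (x : ℕ × ℕ × ℕ) : g.putFun f x g.q = x.2.2 := by
  simp [putFun, g.hmq.symm, g.hpq.symm]
theorem putFun_of_notMem (f : I → ℕ) (x : ℕ × ℕ × ℕ) {i : I} (hi : i ∉ g.target) :
    g.putFun f x i = f i := by
  simp only [mem_target, not_or] at hi
  simp [putFun, hi]
@[simp] theorem putFun_l (f : I → ℕ) (x : ℕ × ℕ × ℕ) : g.putFun f x g.l = f g.l :=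
  g.putFun_of_notMem _ _ g.l_notMem
@[simp] theorem putFun_r (f : I → ℕ) (x : ℕ × ℕ × ℕ) : g.putFun f x g.r = f g.r :=
  g.putFun_of_notMem _ _ g.r_notMem

abbrev Label (d : I → ℕ) : Type := Fin (d g.m) × Fin (d g.p) × Fin (d g.q)

variable {g} {d d' : I → ℕ}

def put (hc : g.Compat d d') (f : Labelling d') (x : g.Label d) : Labelling d :=
  ⟨g.putFun f.1 (x.1, x.2.1, x.2.2), fun i => by
    unfold putFun
    split_ifs with h1 h2 h3
    · subst h1; exact x.1.2
    · subst h2; exact x.2.1.2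
    · subst h3; exact x.2.2.2
    · rw [hc i (by simp [mem_target, h1, h2, h3])]; exact f.2 i⟩

theorem put_congr (hc : g.Compat d d') {f f' : Labelling d'} {x : g.Label d} {i : I}
    (h : i ∉ g.target → f.1 i = f'.1 i) : (put hc f x).1 i = (put hc f' x).1 i := by
  by_cases hi : i ∈ g.target
  · rcases hi with rfl | rfl | rfl <;> simp [put]
  · simpa [put, putFun_of_notMem _ _ _ hi] using h hi

variable [Fintype I]

theorem sum_ite_eq_sum_put (hc : g.Compat d d') (f : Labelling d') (F : Labelling d → ℂ)
    [∀ h : Labelling d, Decidable (∀ i, i ∉ g.target → f.1 i = h.1 i)] :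
    (∑ h : Labelling d, if ∀ i, i ∉ g.target → f.1 i = h.1 i then F h else 0) =
      ∑ x : g.Label d, F (put hc f x) := by
  rw [← Finset.sum_filter]
  refine Finset.sum_bij' (fun h _ => (⟨h.1 g.m, h.2 _⟩, ⟨h.1 g.p, h.2 _⟩, ⟨h.1 g.q, h.2 _⟩))
    (fun x _ => put hc f x) ?_ ?_ ?_ ?_ ?_
  · simp
  · intro x _
    simp only [Finset.mem_filter, Finset.mem_univ, true_and]
    intro i hi
    simp [put, putFun_of_notMem _ _ _ hi]
  · intro h hh
    simp only [Finset.mem_filter, Finset.mem_univ, true_and] at hh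
    ext i
    by_cases hi : i ∈ g.target
    · rcases hi with rfl | rfl | rfl <;> simp [put]
    · simp [put, putFun_of_notMem _ _ _ hi, hh i hi]
  · intro x _
    simp [put]
  · intro h hh
    simp only [Finset.mem_filter, Finset.mem_univ, true_and] at hh
    congr 1
    ext i
    by_cases hi : i ∈ g.target
    · rcases hi with rfl | rfl | rfl <;> simp [put]
    · simp [put, putFun_of_notMem _ _ _ hi, hh i hi]

def elemPut (g : Gate I) (f : Labelling d') (x : g.Label d) : ℂ :=
  g.amp (f.1 g.l) (f.1 g.r) (f.1 g.m) x.1 (f.1 g.p) (f.1 g.q) x.2.1 x.2.2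

/-- Only inputs that agree with the output off the targets contribute, so the sums run over target
labels alone. -/
theorem conj_apply (hc : g.Compat d d') (B : Matrix (Labelling d) (Labelling d) ℂ)
    (f f' : Labelling d') : (g.mat d d' * B * (g.mat d d')ᴴ) f f' =
      ∑ x : g.Label d, ∑ y : g.Label d,
        g.elemPut f x * star (g.elemPut f' y) * B (put hc f x) (put hc f' y) := by
  have e : ∀ (f : Labelling d') (x : g.Label d), g.elem f.1 (put hc f x).1 = g.elemPut f x := by
    intro f x; simp [elem, elemPut, put]
  have row : ∀ h', (g.mat d d' * B) f h' = ∑ x : g.Label d, g.elemPut f x * B (put hc f x) h' := by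
    intro h'
    rw [Matrix.mul_apply]
    simp only [mat_apply, ite_mul, zero_mul]
    refine Eq.trans (@sum_ite_eq_sum_put _ _ _ _ _ _ hc f
      (fun h => g.elem f.1 h.1 * B h h') fun _ => Classical.propDecidable _) ?_
    simp only [e]
  rw [Matrix.mul_apply]
  simp only [row, mat_apply, Matrix.conjTranspose_apply, apply_ite star, star_zero,
    mul_ite, mul_zero]
  refine Eq.trans (@sum_ite_eq_sum_put _ _ _ _ _ _ hc f'
    (fun h => (∑ x : g.Label d, g.elemPut f x * B (put hc f x) h) * star (g.elem f'.1 h.1))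
    fun _ => Classical.propDecidable _) ?_
  simp only [e, Finset.sum_mul]
  rw [Finset.sum_comm]
  refine Finset.sum_congr rfl fun x _ => Finset.sum_congr rfl fun y _ => ?_
  ring

/-- The controls `l` and `r` may lie in `D'`, since the gate preserves their labels, but not in
`J'`, since its amplitudes depend on them. -/
theorem isLocal_conj (hc : g.Compat d d') {J D J' D' : Set I} (hJD : J ⊆ D) (hJ : J' ⊆ J)
    (hD : D' ⊆ D) (ht : ∀ i ∈ g.target, i ∉ D') (htJ : ∀ i ∈ g.target, i ∉ J') (hl : g.l ∉ J')
    (hr : g.r ∉ J')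
    {B : Matrix (Labelling d) (Labelling d) ℂ} (hB : IsLocal J D B) :
    IsLocal J' D' (g.mat d d' * B * (g.mat d d')ᴴ) where
  diag f f' i hi h := by
    rw [conj_apply hc]
    refine Finset.sum_eq_zero fun x _ => Finset.sum_eq_zero fun y _ => ?_
    have hit : i ∉ g.target := fun h => ht i h hi
    rw [hB.diag _ _ i (hD hi) (by simpa [put, putFun_of_notMem _ _ _ hit] using h), mul_zero]
  indep f k f' k' hf hk h h' := by
    rw [conj_apply hc, conj_apply hc]
    refine Finset.sum_congr rfl fun x _ => Finset.sum_congr rfl fun y _ => ?_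
    have hm := htJ g.m (Or.inl rfl)
    have hp := htJ g.p (Or.inr (Or.inl rfl))
    have hq := htJ g.q (Or.inr (Or.inr rfl))
    congr 1
    · simp only [elemPut, hf _ hm, hf _ hp, hf _ hq, hf _ hl, hf _ hr, hk _ hm, hk _ hp, hk _ hq,
        hk _ hl, hk _ hr]
    · refine (hB.mono hJD hJ subset_rfl).congr (hJ.trans hJD)
        (fun i hi => put_congr hc fun _ => hf i hi) (fun i hi => put_congr hc fun _ => hk i hi)
        fun i hi => ?_
      have hit : i ∉ g.target := fun h => htJ i h hi
      simp [put, putFun_of_notMem _ _ _ hit, h i hi, h' i hi]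

/-- A gate inside the region on which `B` acts as the identity does not change `B`. -/
theorem isLocal_conj_of_isCoisometry (hd : ∀ i, 0 < d i) (hc : g.Compat d d')
    (hg : g.IsCoisometry d d') {J D : Set I} (hJD : J ⊆ D) (ht : g.target ⊆ J) (hl : g.l ∈ D)
    (hr : g.r ∈ D) {B : Matrix (Labelling d) (Labelling d) ℂ} (hB : IsLocal J D B) :
    IsLocal J D (g.mat d d' * B * (g.mat d d')ᴴ) := by
  classical
  -- An arbitrary reference label: `B` is the identity on the targets, so its entries do not depend
  -- on the choice.
  let x₀ : g.Label d := (⟨0, hd _⟩, ⟨0, hd _⟩, ⟨0, hd _⟩)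
  have hm : g.m ∈ J := ht (Or.inl rfl)
  have hp : g.p ∈ J := ht (Or.inr (Or.inl rfl))
  have hq : g.q ∈ J := ht (Or.inr (Or.inr rfl))
  have key : ∀ f f' : Labelling d', (g.mat d d' * B * (g.mat d d')ᴴ) f f' =
      if f.1 g.m = f'.1 g.m ∧ f.1 g.p = f'.1 g.p ∧ f.1 g.q = f'.1 g.q
      then B (put hc f x₀) (put hc f' x₀) else 0 := by
    intro f f'
    rw [conj_apply hc]
    have h1 : ∀ x y : g.Label d, B (put hc f x) (put hc f' y) =
        if y = x then B (put hc f x₀) (put hc f' x₀) else 0 := by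
      intro x y
      split_ifs with h
      · subst h
        refine hB.congr hJD (fun i hi => ?_) (fun i hi => ?_) (fun i hi => ?_)
        · have : i ∉ g.target := fun h => hi (ht h)
          simp [put, putFun_of_notMem _ _ _ this]
        · have : i ∉ g.target := fun h => hi (ht h)
          simp [put, putFun_of_notMem _ _ _ this]
        · by_cases hi : i ∈ g.target
          · rcases hi with rfl | rfl | rfl <;> simp [put]
          · simp [put, putFun_of_notMem _ _ _ hi]
      · by_contra hne
        refine h (Prod.ext ?_ (Prod.ext ?_ ?_)) <;> apply Fin.ext <;> by_contra hxy
        · exact hne (hB.diag _ _ g.m (hJD hm) (by simpa [put] using fun e => hxy e.symm))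
        · exact hne (hB.diag _ _ g.p (hJD hp) (by simpa [put] using fun e => hxy e.symm))
        · exact hne (hB.diag _ _ g.q (hJD hq) (by simpa [put] using fun e => hxy e.symm))
    -- Orthonormality of rows holds only for equal control labels in both copies of the gate;
    -- diagonality of `B` in `l` and `r` disposes of the other case.
    have h2 : f.1 g.l ≠ f'.1 g.l ∨ f.1 g.r ≠ f'.1 g.r → B (put hc f x₀) (put hc f' x₀) = 0 := by
      rintro (h | h)
      · exact hB.diag _ _ _ hl (by simpa [put] using h)
      · exact hB.diag _ _ _ hr (by simpa [put] using h)
    generalize B (put hc f x₀) (put hc f' x₀) = β at h1 h2 ⊢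
    simp only [h1, mul_ite, mul_zero, Finset.sum_ite_eq', Finset.mem_univ, if_true,
      ← Finset.sum_mul]
    by_cases hlr : f.1 g.l = f'.1 g.l ∧ f.1 g.r = f'.1 g.r
    · simp only [elemPut, Fintype.sum_prod_type]
      rw [← hlr.1, ← hlr.2]
      have hl' := f.2 g.l
      have hr' := f.2 g.r
      rw [← hc _ g.l_notMem] at hl'
      rw [← hc _ g.r_notMem] at hr'
      rw [hg _ hl' _ hr' _ (f.2 _) _ (f'.2 _) _ (f.2 _) _ (f'.2 _) _ (f.2 _) _ (f'.2 _)]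
      simp
    · simp [h2 (not_and_or.1 hlr)]
  constructor
  · intro f f' i hi h
    rw [key]
    split_ifs with hT
    · refine hB.diag _ _ i hi ?_
      have : i ∉ g.target := by
        rintro (rfl | rfl | rfl)
        exacts [h hT.1, h hT.2.1, h hT.2.2]
      simpa [put, putFun_of_notMem _ _ _ this] using h
    · rfl
  · intro f k f' k' hf hk h h'
    rw [key, key, if_pos ⟨h _ hm, h _ hp, h _ hq⟩, if_pos ⟨h' _ hm, h' _ hp, h' _ hq⟩]
    exact hB.congr hJD (fun i hi => put_congr hc fun _ => hf i hi)
      (fun i hi => put_congr hc fun _ => hk i hi)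
      fun i hi => by rw [put_congr hc fun _ => h i hi, put_congr hc fun _ => h' i hi]; simp

end Gate

/-! ### Horizontal unitarity at the light front -/

open Labelling

namespace Gate

variable {I : Type*} [DecidableEq I] [Fintype I] {g : Gate I} {d d' : I → ℕ}

/-- If the gate enters the region on which `A` acts as the identity from the left, then, by
horizontal unitarity, `A` sees only the identity on the right wire of the gate. -/
theorem exists_trace_mul_conj_eq (hd : ∀ i, 0 < d i) (hd' : ∀ i, 0 < d' i) (hc : g.Compat d d')
    {c : ℂ} (hg : g.IsHorizontalIsometry d d' c) {J D : Set I} (hJD : J ⊆ D) (hl : g.l ∈ J)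
    (hp : g.p ∈ J) (hm : g.m ∈ D) {B : Matrix (Labelling d) (Labelling d) ℂ}
    (hB : IsLocal J D B) :
    ∃ B' : Matrix (Labelling d') (Labelling d') ℂ,
      IsLocal (J ∪ {g.m, g.q}) (D ∪ {g.r, g.q}) B' ∧
      ∀ A, IsLocal J D A → (A * (g.mat d d' * B * (g.mat d d')ᴴ)).trace = (A * B').trace := by
  classical
  unfold IsHorizontalIsometry at hg
  rw [hc _ g.l_notMem, hc _ g.r_notMem] at hg
  -- The entries of `B` as seen through the gate: the input labels of `m` and of `p` must agree in
  -- both copies, and the one of `p` has no influence, whence the default 0.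
  let β (f f' : Labelling d') (b : Fin (d g.m)) (q q' : Fin (d g.q)) : ℂ :=
    B (put hc f (b, ⟨0, hd _⟩, q)) (put hc f' (b, ⟨0, hd _⟩, q'))
  -- The number of values averaged over. The factor `N⁻¹ * c` in `B'` comes from the averaging and
  -- from the horizontal normalization.
  let N : ℂ := Fintype.card (Fin (d' g.l) × Fin (d' g.p))
  have hN : N ≠ 0 := by simp [N, (hd' _).ne']
  let B' : Matrix (Labelling d') (Labelling d') ℂ := Matrix.of fun f f' =>
    if f.1 g.l = f'.1 g.l ∧ f.1 g.p = f'.1 g.p ∧ f.1 g.m = f'.1 g.m ∧ f.1 g.r = f'.1 g.r ∧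
      f.1 g.q = f'.1 g.q then N⁻¹ * (c * ∑ b, ∑ q, β f f' b q q) else 0
  let φ (x : Fin (d' g.l) × Fin (d' g.p)) (f : Labelling d') : Labelling d' :=
    update (update f g.l x.1) g.p x.2
  let π (f : Labelling d') : Fin (d' g.l) × Fin (d' g.p) := (⟨f.1 g.l, f.2 _⟩, ⟨f.1 g.p, f.2 _⟩)
  have φl : ∀ x f, (φ x f).1 g.l = x.1 := fun x f => by simp [φ, update, g.hlp]
  have φp : ∀ x f, (φ x f).1 g.p = x.2 := fun x f => by simp [φ, update]
  have φo : ∀ x f i, i ≠ g.l → i ≠ g.p → (φ x f).1 i = f.1 i := fun x f i h1 h2 => by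
    simp [φ, update, h1, h2]
  have φ_ext : ∀ x (f f' : Labelling d'), f'.1 g.l = x.1 → f'.1 g.p = x.2 →
      (∀ i, i ≠ g.l → i ≠ g.p → f'.1 i = f.1 i) → φ x f = f' := by
    intro x f f' h1 h2 h3
    ext i
    by_cases hil : i = g.l
    · rw [hil, φl, h1]
    by_cases hip : i = g.p
    · rw [hip, φp, h2]
    rw [φo _ _ _ hil hip, h3 _ hil hip]
  have hπ : ∀ f f', π f = π f' ↔ f.1 g.l = f'.1 g.l ∧ f.1 g.p = f'.1 g.p := fun f f' => by
    simp [π, Prod.ext_iff]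
  -- The sum over the averaged outputs `l`, `p` and the common input label of `p` is exactly the
  -- contraction of the left side of the gate with its conjugate. It forces `r` and both labels of
  -- `q` to agree.
  have inner : ∀ (f f' : Labelling d'), f.1 g.l = f'.1 g.l → f.1 g.m = f'.1 g.m →
      ∑ x, (g.mat d d' * B * (g.mat d d')ᴴ) (φ x f) (φ x f') =
        if f.1 g.r = f'.1 g.r ∧ f.1 g.q = f'.1 g.q then c * ∑ b, ∑ q, β f f' b q q else 0 := by
    intro f f' hll hmm
    have h1 : ∀ (z : Fin (d' g.l) × Fin (d' g.p)) (x y : g.Label d),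
        B (put hc (φ z f) x) (put hc (φ z f') y) =
          if y.1 = x.1 ∧ y.2.1 = x.2.1 then β f f' x.1 x.2.2 y.2.2 else 0 := by
      intro z x y
      split_ifs with h
      · refine hB.congr hJD (fun i hi => ?_) (fun i hi => ?_) (fun i hi => ?_)
        · have h1 : i ≠ g.l := fun e => hi (e ▸ hl)
          have h2 : i ≠ g.p := fun e => hi (e ▸ hp)
          simp [put, putFun, φo _ _ _ h1 h2, h2]
        · have h1 : i ≠ g.l := fun e => hi (e ▸ hl)
          have h2 : i ≠ g.p := fun e => hi (e ▸ hp)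
          simp [put, putFun, φo _ _ _ h1 h2, h2, h.1]
        · by_cases hi : i ∈ g.target
          · rcases hi with rfl | rfl | rfl <;> simp [put, h.1, h.2]
          · have h2 : i ≠ g.p := fun e => hi (Or.inr (Or.inl e))
            simp only [put, putFun_of_notMem _ _ _ hi]
            by_cases hil : i = g.l
            · subst hil
              simp [φl, hll]
            · rw [φo _ _ _ hil h2, φo _ _ _ hil h2]
      · by_contra hne
        refine h ⟨?_, ?_⟩ <;> apply Fin.ext <;> by_contra hxy
        · exact hne (hB.diag _ _ g.m hm (by simpa [put] using fun e => hxy e.symm))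
        · exact hne (hB.diag _ _ g.p (hJD hp) (by simpa [put] using fun e => hxy e.symm))
    have h2 : ∀ z : Fin (d' g.l) × Fin (d' g.p),
        (g.mat d d' * B * (g.mat d d')ᴴ) (φ z f) (φ z f') =
        ∑ b : Fin (d g.m), ∑ q₂, ∑ q₂', ∑ q₁ : Fin (d g.p), β f f' b q₂ q₂' *
          (g.amp z.1 (f.1 g.r) (f.1 g.m) b z.2 (f.1 g.q) q₁ q₂ *
          star (g.amp z.1 (f'.1 g.r) (f.1 g.m) b z.2 (f'.1 g.q) q₁ q₂')) := by
      intro z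
      have hr : ∀ f, (φ z f).1 g.r = f.1 g.r := fun f => φo _ _ _ g.hlr.symm g.hrp
      have hm' : ∀ f, (φ z f).1 g.m = f.1 g.m := fun f => φo _ _ _ g.hlm.symm g.hmp
      have hq : ∀ f, (φ z f).1 g.q = f.1 g.q := fun f => φo _ _ _ g.hlq.symm g.hpq.symm
      rw [conj_apply hc]
      simp only [h1, elemPut, φl, φp, hr, hm', hq, Fintype.sum_prod_type, ite_and, mul_ite,
        mul_zero, hmm]
      refine Finset.sum_congr rfl fun b _ => ?_
      simp only [Finset.sum_ite_irrel, Finset.sum_const_zero, Finset.sum_ite_eq', Finset.mem_univ,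
        if_true]
      rw [Finset.sum_comm]
      refine Finset.sum_congr rfl fun q _ => ?_
      rw [Finset.sum_comm]
      refine Finset.sum_congr rfl fun q' _ => Finset.sum_congr rfl fun q₁ _ => ?_
      ring
    have h3 : ∀ b q₂ q₂', ∑ z : Fin (d' g.l) × Fin (d' g.p), ∑ q₁ : Fin (d g.p), β f f' b q₂ q₂' *
          (g.amp z.1 (f.1 g.r) (f.1 g.m) b z.2 (f.1 g.q) q₁ q₂ *
          star (g.amp z.1 (f'.1 g.r) (f.1 g.m) b z.2 (f'.1 g.q) q₁ q₂')) =
        if q₂' = q₂ then (if f.1 g.r = f'.1 g.r ∧ f.1 g.q = f'.1 g.q then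
          c * β f f' b q₂ q₂ else 0) else 0 := by
      intro b q₂ q₂'
      simp only [← Finset.mul_sum, Fintype.sum_prod_type]
      rw [hg _ (f.2 _) _ b.2 _ (f.2 _) _ (f'.2 _) _ (f.2 _) _ (f'.2 _) _ q₂.2 _ q₂'.2]
      by_cases hq : q₂' = q₂
      · subst hq
        simp only [and_true, if_true]
        split_ifs <;> ring
      · rw [if_neg, if_neg hq, mul_zero]
        exact fun h => hq (Fin.ext h.2.2.symm)
    rw [Finset.sum_congr rfl fun z _ => h2 z, Finset.sum_comm]
    refine (Finset.sum_congr rfl fun b _ => Finset.sum_comm.trans (Finset.sum_congr rfl fun q _ =>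
      Finset.sum_comm.trans (Finset.sum_congr rfl fun q' _ => h3 b q q'))).trans ?_
    simp only [Finset.sum_ite_eq', Finset.mem_univ, if_true]
    split_ifs
    · simp only [Finset.mul_sum]
    · simp
  refine ⟨B', ⟨?_, ?_⟩, ?_⟩
  · intro f f' i hi h
    simp only [B', Matrix.of_apply]
    split_ifs with H
    · have hil : i ≠ g.l := by rintro rfl; exact h H.1
      have him : i ≠ g.m := by rintro rfl; exact h H.2.2.1
      have hip : i ≠ g.p := by rintro rfl; exact h H.2.1
      have hir : i ≠ g.r := by rintro rfl; exact h H.2.2.2.1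
      have hiq : i ≠ g.q := by rintro rfl; exact h H.2.2.2.2
      have hiD : i ∈ D := by simpa [hir, hiq] using hi
      rw [Finset.sum_eq_zero, mul_zero, mul_zero]
      refine fun b _ => Finset.sum_eq_zero fun q _ => hB.diag _ _ i hiD ?_
      simpa [put, putFun, him, hip, hiq] using h
    · rfl
  · intro f k f' k' hf hk h h'
    have hcond : ∀ i, f.1 i = k.1 i ↔ f'.1 i = k'.1 i := fun i => by
      by_cases hi : i ∈ J ∪ {g.m, g.q}
      · simp [h i hi, h' i hi]
      · rw [hf i hi, hk i hi]
    simp only [B', Matrix.of_apply, hcond]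
    have hβ : ∀ b q, β f k b q q = β f' k' b q q := by
      intro b q
      refine hB.congr hJD (fun i hi => put_congr hc fun hi' => hf i ?_)
        (fun i hi => put_congr hc fun hi' => hk i ?_) fun i hi => ?_
      · simp only [mem_target, not_or] at hi'
        simp [hi, hi']
      · simp only [mem_target, not_or] at hi'
        simp [hi, hi']
      · rw [put_congr hc fun _ => h i (Or.inl hi), put_congr hc fun _ => h' i (Or.inl hi)]
        simp
    simp only [hβ]
  · intro A hA
    refine mul_left_cancel₀ hN ?_
    refine (trace_mul_average φ π (fun f => φ_ext _ _ _ rfl rfl fun _ _ _ => rfl)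
      (fun x f => Prod.ext (Fin.ext (φl x f)) (Fin.ext (φp x f)))
      (fun x y f => φ_ext _ _ _ (φl _ _) (φp _ _) fun i h1 h2 => by
        rw [φo _ _ _ h1 h2, φo _ _ _ h1 h2]) A _ ?_ ?_).trans ?_
    · intro f f' h
      rw [Ne, hπ, not_and_or] at h
      rcases h with h | h
      · exact hA.diag _ _ _ (hJD hl) h
      · exact hA.diag _ _ _ (hJD hp) h
    · intro x f f' h
      rw [hπ] at h
      have ho : ∀ f i, i ∉ J → (φ x f).1 i = f.1 i := fun f i hi =>
        φo _ _ _ (fun e => hi (e ▸ hl)) (fun e => hi (e ▸ hp))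
      refine hA.congr hJD (ho f) (ho f') fun i hi => ?_
      by_cases hil : i = g.l
      · rw [hil, φl, φl]; simp [h.1]
      by_cases hip : i = g.p
      · rw [hip, φp, φp]; simp [h.2]
      rw [φo _ _ _ hil hip, φo _ _ _ hil hip]
    · rw [← smul_eq_mul N, ← Matrix.trace_smul, ← Matrix.mul_smul]
      refine trace_mul_congr fun f f' => ?_
      -- Horizontal unitarity needs equal upper region labels in both copies; other entries are
      -- killed because `A` is diagonal in `m`.
      by_cases hff : f.1 g.m = f'.1 g.m
      · congr 1
        simp only [Matrix.of_apply, Matrix.smul_apply, B', hπ, smul_eq_mul]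
        by_cases hπ' : f'.1 g.l = f.1 g.l ∧ f'.1 g.p = f.1 g.p
        · rw [if_pos hπ', inner f' f hπ'.1 hff.symm]
          simp only [hπ'.1, hπ'.2, hff, true_and]
          split_ifs
          · rw [mul_inv_cancel_left₀ hN]
          · rw [mul_zero]
        · rw [if_neg hπ', if_neg, mul_zero]
          exact fun h => hπ' ⟨h.1, h.2.1⟩
      · rw [hA.diag _ _ _ hm hff, zero_mul, zero_mul]

end Gate

/-! ### Layers as products of separated gates -/

open Labelling

namespace Gate

variable {I V : Type*} {g : Gate I} {d d' e e' : I → ℕ}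

theorem IsCoisometry.congr (h : g.IsCoisometry d d') (hl : e g.l = d g.l) (hr : e g.r = d g.r)
    (hd : ∀ i ∈ g.target, e i = d i) (hd' : ∀ i ∈ g.target, e' i = d' i) :
    g.IsCoisometry e e' := by
  have m : g.m ∈ g.target := Or.inl rfl
  have p : g.p ∈ g.target := Or.inr (Or.inl rfl)
  have q : g.q ∈ g.target := Or.inr (Or.inr rfl)
  unfold IsCoisometry
  rw [hl, hr, hd _ m, hd _ p, hd _ q, hd' _ m, hd' _ p, hd' _ q]
  exact h

theorem IsHorizontalIsometry.congr {c : ℂ} (h : g.IsHorizontalIsometry d d' c)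
    (hl : e g.l = d g.l) (hr : e g.r = d g.r)
    (hd : ∀ i ∈ g.target, e i = d i) (hd' : ∀ i ∈ g.target, e' i = d' i) :
    g.IsHorizontalIsometry e e' c := by
  have m : g.m ∈ g.target := Or.inl rfl
  have p : g.p ∈ g.target := Or.inr (Or.inl rfl)
  have q : g.q ∈ g.target := Or.inr (Or.inr rfl)
  unfold IsHorizontalIsometry
  rw [hl, hr, hd _ m, hd _ p, hd _ q, hd' _ m, hd' _ p, hd' _ q]
  exact h

theorem IsCoisometry.mirror (h : g.IsCoisometry d d') : g.mirror.IsCoisometry d d' := by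
  intro l hl r hr a ha a' ha' p₁ h₁ p₁' h₁' p₂ h₂ p₂' h₂'
  simp only [Gate.mirror]
  refine (Finset.sum_congr rfl fun b _ => Finset.sum_comm).trans
    ((h r hr l hl a ha a' ha' p₂ h₂ p₂' h₂' p₁ h₁ p₁' h₁').trans ?_)
  simp only [and_comm (a := p₂ = p₂')]

open Classical in
/-- The product of the gates `G v`, `v ∈ S`, with the identity on all other indices. -/
def layerMat (G : V → Gate I) (S : Finset V) (d d' : I → ℕ) :
    Matrix (Labelling d') (Labelling d) ℂ := Matrix.of fun h f =>
  if ∀ i, (∀ v ∈ S, i ∉ (G v).target) → h.1 i = f.1 i then ∏ v ∈ S, (G v).elem h.1 f.1 else 0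

open Classical in
theorem layerMat_apply (G : V → Gate I) (S : Finset V) (d d' : I → ℕ) (h : Labelling d')
    (f : Labelling d) : layerMat G S d d' h f =
    if ∀ i, (∀ v ∈ S, i ∉ (G v).target) → h.1 i = f.1 i then
      ∏ v ∈ S, (G v).elem h.1 f.1 else 0 := rfl

/-- The gates of a layer do not touch the targets of each other. -/
def Separated (G : V → Gate I) (S : Finset V) : Prop :=
  ∀ v ∈ S, ∀ w ∈ S, v ≠ w → ∀ i ∈ (G v).target, i ∉ (G w).target ∧ i ≠ (G w).l ∧ i ≠ (G w).r

/-- Only the dimensions of the targets of the gates change. -/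
def LayerCompat (G : V → Gate I) (S : Finset V) (d d' : I → ℕ) : Prop :=
  ∀ i, (∀ v ∈ S, i ∉ (G v).target) → d i = d' i

theorem Separated.subset {G : V → Gate I} {S S' : Finset V} (h : Separated G S) (hS : S' ⊆ S) :
    Separated G S' := fun v hv w hw => h v (hS hv) w (hS hw)

theorem Separated.l_notMem {G : V → Gate I} {S : Finset V} (h : Separated G S) {v w : V}
    (hv : v ∈ S) (hw : w ∈ S) : (G v).l ∉ (G w).target := by
  by_cases e : w = v
  · subst e; exact (G w).l_notMem
  · exact fun hl => (h w hw v hv e _ hl).2.1 rfl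

theorem Separated.r_notMem {G : V → Gate I} {S : Finset V} (h : Separated G S) {v w : V}
    (hv : v ∈ S) (hw : w ∈ S) : (G v).r ∉ (G w).target := by
  by_cases e : w = v
  · subst e; exact (G w).r_notMem
  · exact fun hl => (h w hw v hv e _ hl).2.2 rfl

theorem layerMat_conjTranspose {G : V → Gate I} {S : Finset V} (hS : Separated G S)
    (d d' : I → ℕ) : (layerMat G S d d')ᴴ = layerMat (fun v => (G v).adjoint) S d' d := by
  ext f h
  simp only [layerMat_apply, Matrix.conjTranspose_apply]
  by_cases H : ∀ i, (∀ v ∈ S, i ∉ (G v).target) → h.1 i = f.1 i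
  · rw [if_pos H]
    refine Eq.trans ?_ (if_pos fun i hi => (H i hi).symm).symm
    rw [star_prod]
    refine Finset.prod_congr rfl fun v hv => (elem_adjoint _ ?_ ?_).symm
    · exact H _ fun w hw => hS.l_notMem hv hw
    · exact H _ fun w hw => hS.r_notMem hv hw
  · rw [if_neg H, star_zero]
    exact (if_neg fun H' => H fun i hi => (H' i hi).symm).symm

theorem layerMat_empty [Fintype I] (G : V → Gate I) (d : I → ℕ) : layerMat G ∅ d d = 1 := by
  ext h f
  simp [layerMat_apply, Matrix.one_apply, Subtype.ext_iff, funext_iff]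

/-- `d''` gives the dimensions when every gate of the layer except `g` has acted, so that `g` can be
split off as the last factor. -/
theorem exists_intermediate (g : Gate I) (hd : ∀ i, 0 < d i) (hd' : ∀ i, 0 < d' i) :
    ∃ d'' : I → ℕ, g.Compat d'' d' ∧ (∀ i ∈ g.target, d'' i = d i) ∧ ∀ i, 0 < d'' i := by
  classical
  refine ⟨fun i => if i ∈ g.target then d i else d' i, fun i hi => if_neg hi,
    fun i hi => if_pos hi, fun i => ?_⟩
  dsimp only
  split_ifs
  exacts [hd i, hd' i]

theorem LayerCompat.of_insert [DecidableEq V] {G : V → Gate I} {S : Finset V} {v : V} {d'' : I → ℕ}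
    (hc : LayerCompat G (insert v S) d d') (h1 : (G v).Compat d'' d')
    (h2 : ∀ i ∈ (G v).target, d'' i = d i) : LayerCompat G S d d'' := by
  intro i hi
  by_cases hiv : i ∈ (G v).target
  · rw [h2 i hiv]
  · rw [h1 i hiv]
    refine hc i fun w hw => ?_
    rcases Finset.mem_insert.1 hw with rfl | hw
    exacts [hiv, hi w hw]

variable [Fintype I] [DecidableEq I] [DecidableEq V]

theorem layerMat_insert {G : V → Gate I} {S : Finset V} {v : V} (hv : v ∉ S)
    (hS : Separated G (insert v S)) {d d'' d' : I → ℕ} (h1 : (G v).Compat d'' d')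
    (h2 : ∀ i ∈ (G v).target, d'' i = d i) :
    layerMat G (insert v S) d d' = (G v).mat d'' d' * layerMat G S d d'' := by
  classical
  ext h f
  have hvS : ∀ w ∈ S, v ≠ w := fun w hw e => hv (e ▸ hw)
  have hvi : v ∈ insert v S := Finset.mem_insert_self _ _
  -- The only contributing intermediate labelling: still the input on the targets of `v`, already
  -- the output elsewhere. Separation ensures that no gate alters the controls or targets of
  -- another.
  let k₀ : Labelling d'' := ⟨fun i => if i ∈ (G v).target then f.1 i else h.1 i, fun i => by
    dsimp only
    split_ifs with hi
    · rw [h2 i hi]; exact f.2 i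
    · rw [h1 i hi]; exact h.2 i⟩
  have k1 : ∀ i ∈ (G v).target, k₀.1 i = f.1 i := fun i hi => if_pos hi
  have k2 : ∀ i, i ∉ (G v).target → k₀.1 i = h.1 i := fun i hi => if_neg hi
  rw [Matrix.mul_apply, Finset.sum_eq_single k₀]
  · simp only [layerMat_apply, mat_apply]
    rw [if_pos fun i hi => (k2 i hi).symm]
    by_cases H : ∀ i, (∀ w ∈ insert v S, i ∉ (G w).target) → h.1 i = f.1 i
    · rw [if_pos H, if_pos, Finset.prod_insert hv]
      · congr 1
        · have hl := H _ fun w hw => hS.l_notMem hvi hw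
          have hr := H _ fun w hw => hS.r_notMem hvi hw
          simp only [elem, k2 _ (G v).l_notMem, k2 _ (G v).r_notMem, hl, hr,
            k1 _ (Or.inl rfl), k1 _ (Or.inr (Or.inl rfl)), k1 _ (Or.inr (Or.inr rfl))]
        · refine Finset.prod_congr rfl fun w hw => ?_
          have hT : ∀ i ∈ (G w).target, k₀.1 i = h.1 i := fun i hi => k2 i
            (hS w (Finset.mem_insert_of_mem hw) v hvi (hvS w hw).symm i hi).1
          simp only [elem, hT _ (Or.inl rfl), hT _ (Or.inr (Or.inl rfl)),
            hT _ (Or.inr (Or.inr rfl))]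
      · intro i hi
        by_cases hiv : i ∈ (G v).target
        · exact k1 i hiv
        · rw [k2 i hiv]
          refine H i fun w hw => ?_
          rcases Finset.mem_insert.1 hw with rfl | hw
          exacts [hiv, hi w hw]
    · rw [if_neg H, if_neg, mul_zero]
      intro H'
      refine H fun i hi => ?_
      rw [← k2 i (hi v hvi)]
      exact H' i fun w hw => hi w (Finset.mem_insert_of_mem hw)
  · intro k _ hk
    simp only [layerMat_apply, mat_apply]
    split_ifs with c1 c2
    · refine absurd (Subtype.ext (funext fun i => ?_)) hk
      by_cases hi : i ∈ (G v).target
      · rw [k1 i hi]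
        exact c2 i fun w hw => (hS v hvi w (Finset.mem_insert_of_mem hw) (hvS w hw) i hi).1
      · rw [k2 i hi, c1 i hi]
    · rw [mul_zero]
    · rw [zero_mul]
    · rw [zero_mul]
  · simp

/-- The gate is inside the region on which `J`, `D`-local operators act as the identity, or
it does not meet that region. -/
def Avoids (g : Gate I) (J D : Set I) : Prop :=
  (g.target ⊆ J ∧ g.l ∈ D ∧ g.r ∈ D) ∨
  ((∀ i ∈ g.target, i ∉ D ∧ i ∉ J) ∧ g.l ∉ J ∧ g.r ∉ J)

/-- Induction on the gates: one inside the region cancels against its adjoint, one outside does not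
reach it. -/
theorem isLocal_layerMat_conj {G : V → Gate I} {J D : Set I} (hJD : J ⊆ D)
    (hd : ∀ i, 0 < d i) {B : Matrix (Labelling d) (Labelling d) ℂ} (hB : IsLocal J D B)
    (S : Finset V) : ∀ d' : I → ℕ, (∀ i, 0 < d' i) → Separated G S → LayerCompat G S d d' →
    (∀ v ∈ S, (G v).IsCoisometry d d') → (∀ v ∈ S, (G v).Avoids J D) →
    IsLocal J D (layerMat G S d d' * B * (layerMat G S d d')ᴴ) := by
  induction S using Finset.induction_on with
  | empty =>
    intro d' _ _ hc _ _
    obtain rfl : d = d' := funext fun i => hc i (by simp)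
    simpa [layerMat_empty] using hB
  | insert v S hv ih =>
    intro d' hd' hS hc hco hav
    obtain ⟨d'', h1, h2, hd''⟩ := exists_intermediate (G v) hd hd'
    have hvi : v ∈ insert v S := Finset.mem_insert_self _ _
    have hsub : S ⊆ insert v S := Finset.subset_insert _ _
    have hc' := hc.of_insert h1 h2
    have hB' := ih d'' hd'' (hS.subset hsub) hc' (fun w hw =>
        (hco w (hsub hw)).congr rfl rfl (fun _ _ => rfl) fun i hi => h1 i
          (hS w (hsub hw) v hvi (fun e => hv (e ▸ hw)) i hi).1)
      (fun w hw => hav w (hsub hw))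
    rw [layerMat_insert hv hS h1 h2]
    have : (G v).mat d'' d' * layerMat G S d d'' * B * ((G v).mat d'' d' * layerMat G S d d'')ᴴ =
        (G v).mat d'' d' * (layerMat G S d d'' * B * (layerMat G S d d'')ᴴ) *
          ((G v).mat d'' d')ᴴ := by
      rw [Matrix.conjTranspose_mul]; simp only [Matrix.mul_assoc]
    rw [this]
    rcases hav v hvi with ⟨ht, hl, hr⟩ | ⟨ht, hl, hr⟩
    · refine isLocal_conj_of_isCoisometry hd'' h1 ?_ hJD ht hl hr hB'
      refine (hco v hvi).congr ?_ ?_ h2 fun _ _ => rfl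
      · exact (hc' _ fun w hw => hS.l_notMem hvi (hsub hw)).symm
      · exact (hc' _ fun w hw => hS.r_notMem hvi (hsub hw)).symm
    · exact isLocal_conj h1 hJD subset_rfl subset_rfl (fun i hi => (ht i hi).1)
        (fun i hi => (ht i hi).2) hl hr hB'

end Gate

/-! ### Propagation along a light front -/

open Labelling

namespace Gate

variable {I V : Type*} [Fintype I] [DecidableEq I] [DecidableEq V]

/-- One layer of a circuit, in which the gate `v₀` moves the boundary of the region on which the
local operators act as the identity.  Operators that evolve backward go from `J₁`, `D₁` to
`J₀`, `D₀`, and operators that evolve forward go from `J₁`, `D₁` to `J₂`, `D₂`. -/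
structure IsFrontLayer (G : V → Gate I) (S : Finset V) (d d' : I → ℕ) (J₀ D₀ J₁ D₁ J₂ D₂ : Set I)
    (v₀ : V) : Prop where
  separated : Separated G S
  compat : LayerCompat G S d d'
  coisometry : ∀ v ∈ S, (G v).IsCoisometry d d'
  isometry : ∀ v ∈ S, (G v).adjoint.IsCoisometry d' d
  mem : v₀ ∈ S
  horizontal : ∃ c, (G v₀).IsHorizontalIsometry d d' c
  l_mem : (G v₀).l ∈ J₁
  p_mem : (G v₀).p ∈ J₁
  m_mem : (G v₀).m ∈ D₁
  avoids₁ : ∀ v ∈ S, v ≠ v₀ → (G v).Avoids J₁ D₁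
  J₂_subset : J₂ ⊆ J₁ ∪ {(G v₀).m, (G v₀).q}
  D₂_subset : D₂ ⊆ D₁ ∪ {(G v₀).r, (G v₀).q}
  target_notMem : ∀ i ∈ (G v₀).target, i ∉ D₀
  l_notMem : (G v₀).l ∉ J₀
  r_notMem : (G v₀).r ∉ J₀
  avoids₀ : ∀ v ∈ S, v ≠ v₀ → (G v).Avoids J₀ D₀

variable {G : V → Gate I} {S : Finset V} {d d' : I → ℕ} {v₀ : V} {J₀ D₀ J₁ D₁ J₂ D₂ : Set I}

/-- The gates off the front preserve the locality of `B`; the front gate, applied last, then acts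
under the trace against `A`. -/
theorem IsFrontLayer.exists_trace_eq (h : IsFrontLayer G S d d' J₀ D₀ J₁ D₁ J₂ D₂ v₀) (hd : ∀ i, 0 < d i)
    (hd' : ∀ i, 0 < d' i) (hJD : J₁ ⊆ D₁) {B : Matrix (Labelling d) (Labelling d) ℂ}
    (hB : IsLocal J₁ D₁ B) :
    ∃ B' : Matrix (Labelling d') (Labelling d') ℂ,
      IsLocal (J₁ ∪ {(G v₀).m, (G v₀).q}) (D₁ ∪ {(G v₀).r, (G v₀).q}) B' ∧
      ∀ A : Matrix (Labelling d') (Labelling d') ℂ, IsLocal J₁ D₁ A →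
        ((layerMat G S d d')ᴴ * A * layerMat G S d d' * B).trace = (A * B').trace := by
  obtain ⟨c, hc⟩ := h.horizontal
  have hS := h.separated
  have hcompat := h.compat
  obtain ⟨d'', h1, h2, hd''⟩ := exists_intermediate (G v₀) hd hd'
  have hne : ∀ v ∈ S.erase v₀, v ≠ v₀ := fun v hv => (Finset.mem_erase.1 hv).1
  have hsub : ∀ v ∈ S.erase v₀, v ∈ S := fun v hv => (Finset.mem_erase.1 hv).2
  have hins := Finset.insert_erase h.mem
  rw [← hins] at hS hcompat
  have hB₁ := isLocal_layerMat_conj hJD hd hB (S.erase v₀) d'' hd''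
    (hS.subset (Finset.subset_insert _ _)) (hcompat.of_insert h1 h2)
    (fun v hv => (h.coisometry v (hsub v hv)).congr rfl rfl (fun _ _ => rfl) fun i hi => h1 i
      (h.separated v (hsub v hv) v₀ h.mem (hne v hv) i hi).1)
    (fun v hv => h.avoids₁ v (hsub v hv) (hne v hv))
  obtain ⟨B', hB', hA⟩ := exists_trace_mul_conj_eq hd'' hd' h1
    (hc.congr
      ((h1 _ (G v₀).l_notMem).trans (h.compat _ fun w hw => h.separated.l_notMem h.mem hw).symm)
      ((h1 _ (G v₀).r_notMem).trans (h.compat _ fun w hw => h.separated.r_notMem h.mem hw).symm)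
      h2 fun _ _ => rfl) hJD h.l_mem h.p_mem h.m_mem hB₁
  refine ⟨B', hB', fun A hAl => ?_⟩
  rw [← hA A hAl, ← hins, layerMat_insert (Finset.notMem_erase _ _) hS h1 h2,
    Matrix.conjTranspose_mul]
  simp only [hins]
  generalize layerMat G (S.erase v₀) d d'' = L
  generalize (G v₀).mat d'' d' = g
  rw [show Lᴴ * gᴴ * A * (g * L) * B = Lᴴ * gᴴ * (A * (g * L * B)) by simp only [Matrix.mul_assoc],
    Matrix.trace_mul_comm]
  simp only [Matrix.mul_assoc]

/-- In the backward direction the adjoint of the front gate acts first and shrinks `J₁`, `D₁` to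
`J₀`, `D₀`; the remaining gates respect the smaller sets. -/
theorem IsFrontLayer.isLocal (h : IsFrontLayer G S d d' J₀ D₀ J₁ D₁ J₂ D₂ v₀) (hd : ∀ i, 0 < d i)
    (hd' : ∀ i, 0 < d' i) (hJD : J₁ ⊆ D₁) (hJ : J₀ ⊆ J₁) (hD : D₀ ⊆ D₁)
    (hJD₀ : J₀ ⊆ D₀)
    {A : Matrix (Labelling d') (Labelling d') ℂ} (hA : IsLocal J₁ D₁ A) :
    IsLocal J₀ D₀ ((layerMat G S d d')ᴴ * A * layerMat G S d d') := by
  have hS := h.separated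
  have hcompat := h.compat
  obtain ⟨d'', h1, h2, hd''⟩ := exists_intermediate (G v₀) hd hd'
  have hne : ∀ v ∈ S.erase v₀, v ≠ v₀ := fun v hv => (Finset.mem_erase.1 hv).1
  have hsub : ∀ v ∈ S.erase v₀, v ∈ S := fun v hv => (Finset.mem_erase.1 hv).2
  have hins := Finset.insert_erase h.mem
  rw [← hins] at hS hcompat
  have hcompat' := hcompat.of_insert h1 h2
  have hS' := hS.subset (Finset.subset_insert _ _)
  have hA₁ := isLocal_conj (g := (G v₀).adjoint) (d := d') (d' := d'') h1.adjoint hJD hJ hD h.target_notMem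
    (fun i hi hiJ => h.target_notMem i hi (hJD₀ hiJ)) h.l_notMem h.r_notMem hA
  have hA₂ := isLocal_layerMat_conj (G := fun v => (G v).adjoint) hJD₀ hd'' hA₁ (S.erase v₀) d hd
    hS' (fun i hi => (hcompat' i hi).symm)
    (fun v hv => (h.isometry v (hsub v hv)).congr
      (h1 _ (h.separated.l_notMem (hsub v hv) h.mem))
      (h1 _ (h.separated.r_notMem (hsub v hv) h.mem))
      (fun i hi => h1 i (h.separated v (hsub v hv) v₀ h.mem (hne v hv) i hi).1) fun _ _ => rfl)
    (fun v hv => h.avoids₀ v (hsub v hv) (hne v hv))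
  rw [← layerMat_conjTranspose hS', ← mat_conjTranspose, Matrix.conjTranspose_conjTranspose,
    Matrix.conjTranspose_conjTranspose] at hA₂
  rw [← hins, layerMat_insert (Finset.notMem_erase _ _) hS h1 h2, Matrix.conjTranspose_mul]
  simpa only [hins, Matrix.mul_assoc] using hA₂

/-- A circuit in which a light ray bounds the sets `J s`. -/
structure IsLightFront (G : ℕ → V → Gate I) (S : ℕ → Finset V) (d : ℕ → I → ℕ) (t : ℕ)
    (J D : ℕ → Set I) : Prop where
  pos : ∀ s i, 0 < d s i
  sub : ∀ s, J s ⊆ D s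
  J_mono : ∀ s, J s ⊆ J (s + 1)
  D_mono : ∀ s, D s ⊆ D (s + 1)
  front : ∀ s < t, ∃ v₀, IsFrontLayer (G s) (S s) (d s) (d (s + 1)) (J s) (D s) (J (s + 1))
    (D (s + 1)) (J (s + 2)) (D (s + 2)) v₀

/-- The product of the first `t` layers. -/
def evolutionMat (G : ℕ → V → Gate I) (S : ℕ → Finset V) (d : ℕ → I → ℕ) :
    (t : ℕ) → Matrix (Labelling (d t)) (Labelling (d 0)) ℂ
  | 0 => 1
  | t + 1 => layerMat (G t) (S t) (d t) (d (t + 1)) * evolutionMat G S d t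

namespace IsLightFront

variable {G : ℕ → V → Gate I} {S : ℕ → Finset V} {d : ℕ → I → ℕ} {t : ℕ}
    {J D : ℕ → Set I}

theorem isLocal_layer (h : IsLightFront G S d t J D) {s : ℕ} (hs : s < t)
    {A : Matrix (Labelling (d (s + 1))) (Labelling (d (s + 1))) ℂ}
    (hA : IsLocal (J (s + 1)) (D (s + 1)) A) :
    IsLocal (J s) (D s) ((layerMat (G s) (S s) (d s) (d (s + 1)))ᴴ * A *
      layerMat (G s) (S s) (d s) (d (s + 1))) :=
  let ⟨_, h₀⟩ := h.front s hs
  h₀.isLocal (h.pos _) (h.pos _) (h.sub _) (h.J_mono s) (h.D_mono s) (h.sub s) hA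

theorem isLocal_evolution (h : IsLightFront G S d t J D) : ∀ s ≤ t,
    ∀ A : Matrix (Labelling (d s)) (Labelling (d s)) ℂ, IsLocal (J s) (D s) A →
      IsLocal (J 0) (D 0) ((evolutionMat G S d s)ᴴ * A * evolutionMat G S d s)
  | 0, _, A, hA => by simpa [evolutionMat] using hA
  | s + 1, hs, A, hA => by
    have := isLocal_evolution h s (Nat.le_of_succ_le hs) _ (h.isLocal_layer hs hA)
    simpa only [evolutionMat, Matrix.conjTranspose_mul, Matrix.mul_assoc] using this

/-- The sets of `B'` stay one step ahead of those of `A`. Each induction step pulls `A` back through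
one layer and then pushes `B'` forward through it. -/
theorem exists_trace_eq (h : IsLightFront G S d t J D)
    {B : Matrix (Labelling (d 0)) (Labelling (d 0)) ℂ} (hB : IsLocal (J 1) (D 1) B) : ∀ s ≤ t,
    ∃ B' : Matrix (Labelling (d s)) (Labelling (d s)) ℂ, IsLocal (J (s + 1)) (D (s + 1)) B' ∧
      ∀ A : Matrix (Labelling (d s)) (Labelling (d s)) ℂ, IsLocal (J s) (D s) A →
        ((evolutionMat G S d s)ᴴ * A * evolutionMat G S d s * B).trace = (A * B').trace
  | 0, _ => ⟨B, hB, fun A _ => by simp [evolutionMat]⟩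
  | s + 1, hs => by
    obtain ⟨B₁, hB₁, h₁⟩ := exists_trace_eq h hB s (Nat.le_of_succ_le hs)
    obtain ⟨v₀, h₀⟩ := h.front s hs
    obtain ⟨B₂, hB₂, h₂⟩ := h₀.exists_trace_eq (h.pos _) (h.pos _) (h.sub _) hB₁
    refine ⟨B₂, hB₂.mono (Set.union_subset ((h.sub _).trans Set.subset_union_left) ?_)
      h₀.J₂_subset h₀.D₂_subset, fun A hA => ?_⟩
    · rintro i (rfl | rfl)
      · exact Or.inl h₀.m_mem
      · exact Or.inr (Or.inr rfl)
    · rw [← h₂ A hA, ← h₁ _ (h.isLocal_layer hs hA)]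
      simp only [evolutionMat, Matrix.conjTranspose_mul, Matrix.mul_assoc]

theorem trace_eq_zero_of_mem (h : IsLightFront G S d t J D)
    {A : Matrix (Labelling (d t)) (Labelling (d t)) ℂ} (hA : IsLocal (J t) (D t) A) {j : I}
    (hj : j ∈ J 0) {σ : Matrix (Fin (d 0 j)) (Fin (d 0 j)) ℂ} (hσ : σ.trace = 0) :
    ((evolutionMat G S d t)ᴴ * A * evolutionMat G S d t * siteOp (d 0) j σ).trace = 0 :=
  trace_mul_siteOp (h.pos 0) j σ hσ (h.sub 0) hj (h.isLocal_evolution t le_rfl A hA)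

theorem trace_eq_zero_of_isLocal (h : IsLightFront G S d t J D)
    {B : Matrix (Labelling (d 0)) (Labelling (d 0)) ℂ} (hB : IsLocal (J 1) (D 1) B) {o : I}
    (ho : o ∉ D t) (ho' : o ∈ J (t + 1)) {ρ : Matrix (Fin (d t o)) (Fin (d t o)) ℂ}
    (hρ : ρ.trace = 0) :
    ((evolutionMat G S d t)ᴴ * siteOp (d t) o ρ * evolutionMat G S d t * B).trace = 0 := by
  obtain ⟨B', hB', hA⟩ := h.exists_trace_eq hB t le_rfl
  rw [hA _ (isLocal_siteOp o ρ (h.sub t) ho), Matrix.trace_mul_comm]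
  exact trace_mul_siteOp (h.pos t) o ρ hρ (h.sub _) ho' hB'

end IsLightFront

end Gate

/-! ### The shaded circuit as a family of gates -/

namespace ShadedCircuit

variable {n : ℕ} (C : ShadedCircuit n)

/-- The regions and wires of a slice. -/
abbrev Site (n : ℕ) : Type := Fin (n + 2) ⊕ Fin (n + 1)

def dims (s : ℕ) : Site n → ℕ := Sum.elim (fun k => C.regionDim k s) (fun x => C.wireDim x s)

def configEquiv (s : ℕ) : C.Config s ≃ Labelling (C.dims s) where
  toFun c := ⟨Sum.elim (fun k => (c.1 k : ℕ)) (fun x => (c.2 x : ℕ)), by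
    rintro (k | x)
    exacts [(c.1 k).2, (c.2 x).2]⟩
  invFun f := (fun k => ⟨f.1 (.inl k), f.2 (.inl k)⟩, fun x => ⟨f.1 (.inr x), f.2 (.inr x)⟩)
  left_inv _ := rfl
  right_inv f := by
    ext (k | x) <;> rfl

open Classical in
def gate (s : ℕ) (i : Fin n) : Gate (Site n) where
  m := .inl i.succ.castSucc
  p := .inr i.castSucc
  q := .inr i.succ
  l := .inl i.castSucc.castSucc
  r := .inl i.succ.succ
  amp l r a b p₁ p₂ q₁ q₂ :=
    -- Amplitudes are functions of natural numbers, so that slices of different dimensions share one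
    -- label type; the value 0 out of range is a mere default.
    if h : l < C.regionDim i.castSucc.castSucc s ∧ r < C.regionDim i.succ.succ s ∧
      a < C.regionDim i.succ.castSucc (s + 1) ∧ b < C.regionDim i.succ.castSucc s ∧
      p₁ < C.wireDim i.castSucc (s + 1) ∧ p₂ < C.wireDim i.succ (s + 1) ∧
      q₁ < C.wireDim i.castSucc s ∧ q₂ < C.wireDim i.succ s then
      C.tensor i s ⟨l, h.1⟩ ⟨r, h.2.1⟩ ⟨a, h.2.2.1⟩ ⟨b, h.2.2.2.1⟩ ⟨p₁, h.2.2.2.2.1⟩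
        ⟨p₂, h.2.2.2.2.2.1⟩ ⟨q₁, h.2.2.2.2.2.2.1⟩ ⟨q₂, h.2.2.2.2.2.2.2⟩
    else 0
  hmp := by simp
  hmq := by simp
  hpq := by simp [Fin.ext_iff]
  hlr := by simp [Fin.ext_iff]; omega
  hlm := by simp [Fin.ext_iff]
  hlp := by simp
  hlq := by simp
  hrm := by simp [Fin.ext_iff]
  hrp := by simp
  hrq := by simp

theorem gate_amp {s : ℕ} {i : Fin n} (l : Fin (C.regionDim i.castSucc.castSucc s))
    (r : Fin (C.regionDim i.succ.succ s)) (a : Fin (C.regionDim i.succ.castSucc (s + 1)))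
    (b : Fin (C.regionDim i.succ.castSucc s)) (p₁ : Fin (C.wireDim i.castSucc (s + 1)))
    (p₂ : Fin (C.wireDim i.succ (s + 1))) (q₁ : Fin (C.wireDim i.castSucc s))
    (q₂ : Fin (C.wireDim i.succ s)) :
    (C.gate s i).amp l r a b p₁ p₂ q₁ q₂ = C.tensor i s l r a b p₁ p₂ q₁ q₂ :=
  dif_pos ⟨l.2, r.2, a.2, b.2, p₁.2, p₂.2, q₁.2, q₂.2⟩

open Classical in
def vertices (s : ℕ) : Finset (Fin n) := Finset.univ.filter fun i => C.vertex i s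

theorem mem_vertices {s : ℕ} {i : Fin n} : i ∈ C.vertices s ↔ C.vertex i s := by simp [vertices]

theorem straight_iff {s : ℕ} (y : C.Config (s + 1)) (z : C.Config s) : C.Straight s y z ↔
    ∀ i, (∀ v ∈ C.vertices s, i ∉ (C.gate s v).target) →
      (C.configEquiv (s + 1) y).1 i = (C.configEquiv s z).1 i := by
  constructor
  · rintro ⟨h1, h2⟩ (k | x) hi
    · refine h1 k fun i hi' e => hi i (C.mem_vertices.2 hi') (Or.inl (by rw [← e]; rfl))
    · refine h2 x fun i hi' => ⟨fun e => hi i (C.mem_vertices.2 hi') (Or.inr (Or.inl ?_)),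
        fun e => hi i (C.mem_vertices.2 hi') (Or.inr (Or.inr ?_))⟩ <;> rw [← e] <;> rfl
  · intro h
    refine ⟨fun k hk => h (.inl k) fun v hv => ?_, fun x hx => h (.inr x) fun v hv => ?_⟩
    · have := hk v (C.mem_vertices.1 hv)
      simpa [Gate.mem_target, gate, eq_comm] using this
    · have := hx v (C.mem_vertices.1 hv)
      simpa [Gate.mem_target, gate, eq_comm] using this

theorem layer_eq (s : ℕ) : C.layer s = (Gate.layerMat (C.gate s) (C.vertices s) (C.dims s)
    (C.dims (s + 1))).submatrix (C.configEquiv (s + 1)) (C.configEquiv s) := by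
  classical
  ext y z
  rw [Matrix.submatrix_apply, Gate.layerMat_apply, layer]
  by_cases h : C.Straight s y z
  swap
  · rw [if_neg h, if_neg (mt (C.straight_iff y z).2 h)]
  rw [if_pos h, if_pos ((C.straight_iff y z).1 h), vertices, Finset.prod_filter]
  refine Finset.prod_congr rfl fun i _ => ?_
  refine if_congr Iff.rfl ?_ rfl
  exact (C.gate_amp _ _ _ _ _ _ _ _).symm

theorem evolution_eq : ∀ t, C.evolution t = (Gate.evolutionMat C.gate C.vertices C.dims t).submatrix
    (C.configEquiv t) (C.configEquiv 0)
  | 0 => by simp [evolution, Gate.evolutionMat]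
  | t + 1 => by
    rw [evolution, Gate.evolutionMat, evolution_eq t, layer_eq, Matrix.submatrix_mul_equiv]

theorem siteOp_eq {s : ℕ} (x : Fin (n + 1))
    (ρ : Matrix (Fin (C.wireDim x s)) (Fin (C.wireDim x s)) ℂ) :
    C.siteOp x ρ = (Labelling.siteOp (C.dims s) (.inr x) ρ).submatrix (C.configEquiv s)
      (C.configEquiv s) := by
  ext y z
  refine Eq.trans ?_ (Labelling.siteOp_apply (d := C.dims s) (.inr x) ρ _ _).symm
  rw [siteOp]
  have key : (y.1 = z.1 ∧ ∀ x', x' ≠ x → y.2 x' = z.2 x') ↔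
      ∀ i, i ≠ .inr x → (C.configEquiv s y).1 i = (C.configEquiv s z).1 i := by
    refine ⟨?_, fun h => ⟨?_, ?_⟩⟩
    · rintro ⟨h1, h2⟩ (k | x') hj
      · exact congrArg Fin.val (congrFun h1 k)
      · exact congrArg Fin.val (h2 x' fun e => hj (e ▸ rfl))
    · exact funext fun k => Fin.ext (h (.inl k) (by simp))
    · exact fun x' hx' => Fin.ext (h (.inr x') (by simpa using hx'))
  by_cases h : y.1 = z.1 ∧ ∀ x', x' ≠ x → y.2 x' = z.2 x'
  · rw [if_pos h, if_pos (key.1 h)]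
    rfl
  · rw [if_neg h, if_neg (mt key.2 h)]

theorem _root_.Matrix.trace_submatrix_equiv {α β : Type*} [Fintype α] [Fintype β] (e : α ≃ β)
    (M : Matrix β β ℂ) : (M.submatrix e e).trace = M.trace :=
  Equiv.sum_comp e fun f => M f f

theorem correlation_eq_zero {t : ℕ} {o j : Fin (n + 1)}
    {ρ : Matrix (Fin (C.wireDim o t)) (Fin (C.wireDim o t)) ℂ}
    {σ : Matrix (Fin (C.wireDim j 0)) (Fin (C.wireDim j 0)) ℂ}
    (h : ((Gate.evolutionMat C.gate C.vertices C.dims t)ᴴ *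
      Labelling.siteOp (C.dims t) (.inr o) ρ * Gate.evolutionMat C.gate C.vertices C.dims t *
      Labelling.siteOp (C.dims 0) (.inr j) σ).trace = 0) :
    C.correlation t o j ρ σ = 0 := by
  rw [correlation, evolution_eq, siteOp_eq, siteOp_eq, Matrix.conjTranspose_submatrix]
  simp only [Matrix.submatrix_mul_equiv]
  rw [div_eq_zero_iff]
  left
  rw [Matrix.trace_submatrix_equiv, h]

theorem separated (s : ℕ) : Gate.Separated (C.gate s) (C.vertices s) := by
  intro v hv w hw hvw i hi
  have h1 := C.brickwork v s (C.mem_vertices.1 hv)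
  have h2 := C.brickwork w s (C.mem_vertices.1 hw)
  have h3 : (v : ℕ) ≠ w := fun e => hvw (Fin.ext e)
  rw [Nat.even_iff] at h1 h2
  rcases hi with rfl | rfl | rfl <;>
    simp [Gate.mem_target, gate, Fin.ext_iff] <;> omega

theorem layerCompat (s : ℕ) :
    Gate.LayerCompat (C.gate s) (C.vertices s) (C.dims s) (C.dims (s + 1)) := by
  rintro (k | x) hi
  · refine (C.regionDim_straight k s fun i hi' e => ?_).symm
    exact hi i (C.mem_vertices.2 hi') (Or.inl (by rw [← e]; rfl))
  · refine (C.wireDim_straight x s fun i hi' => ⟨fun e => ?_, fun e => ?_⟩).symm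
    · exact hi i (C.mem_vertices.2 hi') (Or.inr (Or.inl (by rw [← e]; rfl)))
    · exact hi i (C.mem_vertices.2 hi') (Or.inr (Or.inr (by rw [← e]; rfl)))

theorem dims_pos (s : ℕ) : ∀ i, 0 < C.dims s i := by
  rintro (k | x)
  exacts [C.regionDim_pos k s, C.wireDim_pos x s]

variable {C} {s : ℕ} {i : Fin n}

theorem gate_isCoisometry (h : (C.tensor i s).IsBiunitary) :
    (C.gate s i).IsCoisometry (C.dims s) (C.dims (s + 1)) := by
  intro l hl r hr a ha a' ha' p₁ h₁ p₁' h₁' p₂ h₂ p₂' h₂'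
  have := congrFun (congrFun (h.1 ⟨l, hl⟩ ⟨r, hr⟩).1 (⟨a, ha⟩, ⟨p₁, h₁⟩, ⟨p₂, h₂⟩))
    (⟨a', ha'⟩, ⟨p₁', h₁'⟩, ⟨p₂', h₂'⟩)
  simp only [Matrix.mul_apply, Fintype.sum_prod_type, Matrix.one_apply, Prod.mk.injEq] at this
  refine Eq.trans ?_ (this.trans
    (if_congr (and_congr Fin.ext_iff (and_congr Fin.ext_iff Fin.ext_iff)) rfl rfl))
  refine Finset.sum_congr rfl fun b _ => Finset.sum_congr rfl fun q _ => Finset.sum_congr rfl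
    fun q' _ => ?_
  exact congrArg₂ (fun x y => x * star y)
    (C.gate_amp ⟨l, hl⟩ ⟨r, hr⟩ ⟨a, ha⟩ b ⟨p₁, h₁⟩ ⟨p₂, h₂⟩ q q')
    (C.gate_amp ⟨l, hl⟩ ⟨r, hr⟩ ⟨a', ha'⟩ b ⟨p₁', h₁'⟩ ⟨p₂', h₂'⟩ q q')

/-- The adjoint reads its controls on the later slice, hence the two equalities of dimensions. -/
theorem gate_adjoint_isCoisometry (h : (C.tensor i s).IsBiunitary)
    (hl' : C.dims (s + 1) (C.gate s i).l = C.dims s (C.gate s i).l)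
    (hr' : C.dims (s + 1) (C.gate s i).r = C.dims s (C.gate s i).r) :
    (C.gate s i).adjoint.IsCoisometry (C.dims (s + 1)) (C.dims s) := by
  intro l hl r hr a ha a' ha' p₁ h₁ p₁' h₁' p₂ h₂ p₂' h₂'
  have hl := hl.trans_eq hl'
  have hr := hr.trans_eq hr'
  have := congrFun (congrFun (h.1 ⟨l, hl⟩ ⟨r, hr⟩).2 (⟨a, ha⟩, ⟨p₁, h₁⟩, ⟨p₂, h₂⟩))
    (⟨a', ha'⟩, ⟨p₁', h₁'⟩, ⟨p₂', h₂'⟩)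
  simp only [Matrix.mul_apply, Fintype.sum_prod_type, Matrix.one_apply, Prod.mk.injEq] at this
  refine Eq.trans ?_ (this.trans
    (if_congr (and_congr Fin.ext_iff (and_congr Fin.ext_iff Fin.ext_iff)) rfl rfl))
  refine Finset.sum_congr rfl fun b _ => Finset.sum_congr rfl fun q _ => Finset.sum_congr rfl
    fun q' _ => ?_
  exact congrArg₂ (fun x y => star x * y)
    (C.gate_amp ⟨l, hl⟩ ⟨r, hr⟩ b ⟨a, ha⟩ q q' ⟨p₁, h₁⟩ ⟨p₂, h₂⟩)
    ((star_star _).trans (C.gate_amp ⟨l, hl⟩ ⟨r, hr⟩ b ⟨a', ha'⟩ q q' ⟨p₁', h₁'⟩ ⟨p₂', h₂'⟩))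

/-- `N†N = λ1` contracts the left side of the vertex; the mirrored version uses `NN† = λ1`. -/
theorem gate_isHorizontalIsometry (h : (C.tensor i s).IsBiunitary) :
    ∃ c, (C.gate s i).IsHorizontalIsometry (C.dims s) (C.dims (s + 1)) c := by
  obtain ⟨c, -, hc⟩ := h.2
  refine ⟨c, ?_⟩
  intro a ha b hb r hr r' hr' p₂ h₂ p₂' h₂' q₂ k₂ q₂' k₂'
  have := congrFun (congrFun (hc ⟨a, ha⟩ ⟨b, hb⟩).2 (⟨r', hr'⟩, ⟨p₂', h₂'⟩, ⟨q₂', k₂'⟩))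
    (⟨r, hr⟩, ⟨p₂, h₂⟩, ⟨q₂, k₂⟩)
  simp only [Matrix.mul_apply, Fintype.sum_prod_type, Matrix.smul_apply, Matrix.one_apply,
    Prod.mk.injEq, smul_eq_mul, mul_ite, mul_one, mul_zero] at this
  refine Eq.trans ?_ (this.trans (if_congr (and_congr (Fin.ext_iff.trans eq_comm)
    (and_congr (Fin.ext_iff.trans eq_comm) (Fin.ext_iff.trans eq_comm))) rfl rfl))
  refine Finset.sum_congr rfl fun l _ => Finset.sum_congr rfl fun p _ => Finset.sum_congr rfl
    fun q _ => ?_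
  refine (mul_comm _ _).trans ?_
  exact congrArg₂ (fun x y => star x * y)
    (C.gate_amp l ⟨r', hr'⟩ ⟨a, ha⟩ ⟨b, hb⟩ p ⟨p₂', h₂'⟩ q ⟨q₂', k₂'⟩)
    (C.gate_amp l ⟨r, hr⟩ ⟨a, ha⟩ ⟨b, hb⟩ p ⟨p₂, h₂⟩ q ⟨q₂, k₂⟩)

theorem gate_mirror_isHorizontalIsometry (h : (C.tensor i s).IsBiunitary) :
    ∃ c, (C.gate s i).mirror.IsHorizontalIsometry (C.dims s) (C.dims (s + 1)) c := by
  obtain ⟨c, -, hc⟩ := h.2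
  refine ⟨c, ?_⟩
  intro a ha b hb r hr r' hr' p₂ h₂ p₂' h₂' q₂ k₂ q₂' k₂'
  have := congrFun (congrFun (hc ⟨a, ha⟩ ⟨b, hb⟩).1 (⟨r, hr⟩, ⟨p₂, h₂⟩, ⟨q₂, k₂⟩))
    (⟨r', hr'⟩, ⟨p₂', h₂'⟩, ⟨q₂', k₂'⟩)
  simp only [Matrix.mul_apply, Fintype.sum_prod_type, Matrix.smul_apply, Matrix.one_apply,
    Prod.mk.injEq, smul_eq_mul, mul_ite, mul_one, mul_zero] at this
  refine Eq.trans ?_ (this.trans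
    (if_congr (and_congr Fin.ext_iff (and_congr Fin.ext_iff Fin.ext_iff)) rfl rfl))
  refine Finset.sum_congr rfl fun l _ => Finset.sum_congr rfl fun p _ => Finset.sum_congr rfl
    fun q _ => ?_
  exact congrArg₂ (fun x y => x * star y)
    (C.gate_amp ⟨r, hr⟩ l ⟨a, ha⟩ ⟨b, hb⟩ ⟨p₂, h₂⟩ p ⟨q₂, k₂⟩ q)
    (C.gate_amp ⟨r', hr'⟩ l ⟨a, ha⟩ ⟨b, hb⟩ ⟨p₂', h₂'⟩ p ⟨q₂', k₂'⟩ q)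

end ShadedCircuit

/-! ### Reflection of gates and layers -/

namespace Gate

variable {I V : Type*} {G : V → Gate I} {S : Finset V}

theorem target_mirror (g : Gate I) : g.mirror.target = g.target := by
  ext i; simp only [mem_target, mirror]; tauto

theorem Separated.mirror (h : Separated G S) : Separated (fun v => (G v).mirror) S := by
  intro v hv w hw hvw i hi
  rw [target_mirror] at hi ⊢
  obtain ⟨h1, h2, h3⟩ := h v hv w hw hvw i hi
  exact ⟨h1, h3, h2⟩

theorem LayerCompat.mirror {d d' : I → ℕ} (h : LayerCompat G S d d') :
    LayerCompat (fun v => (G v).mirror) S d d' := fun i hi =>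
  h i fun v hv => by simpa only [target_mirror] using hi v hv

theorem layerMat_mirror (d d' : I → ℕ) :
    layerMat (fun v => (G v).mirror) S d d' = layerMat G S d d' := by
  ext h f
  rw [layerMat_apply, layerMat_apply]
  have key : (∀ i, (∀ v ∈ S, i ∉ (G v).mirror.target) → h.1 i = f.1 i) ↔
      ∀ i, (∀ v ∈ S, i ∉ (G v).target) → h.1 i = f.1 i := by simp only [target_mirror]
  by_cases H : ∀ i, (∀ v ∈ S, i ∉ (G v).target) → h.1 i = f.1 i
  · rw [if_pos H, if_pos (key.2 H)]
    rfl
  · rw [if_neg H, if_neg (mt key.1 H)]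

theorem evolutionMat_mirror [Fintype I] [DecidableEq I] (G : ℕ → V → Gate I) (S : ℕ → Finset V)
    (d : ℕ → I → ℕ) : ∀ t, evolutionMat (fun s v => (G s v).mirror) S d t = evolutionMat G S d t
  | 0 => rfl
  | t + 1 => by rw [evolutionMat, evolutionMat, layerMat_mirror, evolutionMat_mirror G S d t]

end Gate

/-! ### The two light rays of the brickwork -/

namespace ShadedCircuit

variable {n : ℕ} (C : ShadedCircuit n)

/-- The regions and wires whose positions satisfy `P` and `Q`, respectively. -/
def sitesWith (P Q : ℕ → Prop) : Set (Site n) :=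
  {i | Sum.elim (fun k : Fin (n + 2) => P k) (fun x : Fin (n + 1) => Q x) i}

@[simp] theorem inl_mem_sitesWith {P Q : ℕ → Prop} {k : Fin (n + 2)} :
    (.inl k : Site n) ∈ sitesWith P Q ↔ P k := Iff.rfl

@[simp] theorem inr_mem_sitesWith {P Q : ℕ → Prop} {x : Fin (n + 1)} :
    (.inr x : Site n) ∈ sitesWith P Q ↔ Q x := Iff.rfl

theorem sitesWith_subset {P Q P' Q' : ℕ → Prop} (h : ∀ k, P k → P' k) (h' : ∀ k, Q k → Q' k) :
    (sitesWith P Q : Set (Site n)) ⊆ sitesWith P' Q' := by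
  rintro (k | x) hi
  exacts [h _ hi, h' _ hi]

variable {C}

/-- On slice `s`, `J` consists of the wires and regions strictly left of `o - t + s`; `D` adds the
region `o - t + s`, the left control of the front vertex. Inequalities are kept additive to avoid
truncated subtraction. -/
theorem isLightFront_left (hC : C.IsBiunitary) {t : ℕ} {o : Fin (n + 1)}
    (hcone : C.ContainsLightCone o t) (hpar : Even ((o : ℕ) + t + C.offset)) :
    Gate.IsLightFront C.gate C.vertices C.dims t
      (fun s => sitesWith (fun k => k + t + 1 ≤ o + s) (fun x => x + t + 1 ≤ o + s))
      (fun s => sitesWith (fun k => k + t ≤ o + s) (fun x => x + t + 1 ≤ o + s)) where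
  pos := C.dims_pos
  sub s := sitesWith_subset (fun k h => by omega) fun x h => h
  J_mono s := sitesWith_subset (fun k h => by omega) fun x h => by omega
  D_mono s := sitesWith_subset (fun k h => by omega) fun x h => by omega
  front s hs := by
    obtain ⟨h1, h2, h3⟩ := hcone
    let v₀ : Fin n := ⟨o - t + s, by omega⟩
    have hv₀ : (v₀ : ℕ) = o - t + s := rfl
    rw [Nat.even_iff] at hpar
    -- The parity of `o + t` puts `v₀` on the sublattice of layer `s`; it is the leftmost position
    -- of the cone there.
    have hv : C.vertex v₀ s := h3 s hs v₀ (by rw [Nat.even_iff]; omega) (by omega) (by omega)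
    have hav : ∀ v ∈ C.vertices s, v ≠ v₀ → (v : ℕ) + 2 ≤ v₀ ∨ (v₀ : ℕ) + 2 ≤ v := by
      intro v hv hne
      have := C.brickwork v s (C.mem_vertices.1 hv)
      have hne' : (v : ℕ) ≠ v₀ := fun e => hne (Fin.ext e)
      rw [Nat.even_iff] at this
      omega
    have hcompat := C.layerCompat s
    have hsep := C.separated s
    refine ⟨v₀, hsep, hcompat,
      fun v hv => gate_isCoisometry (hC v s (C.mem_vertices.1 hv)),
      fun v hv => gate_adjoint_isCoisometry (hC v s (C.mem_vertices.1 hv))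
        (hcompat _ fun w hw => hsep.l_notMem hv hw).symm
        (hcompat _ fun w hw => hsep.r_notMem hv hw).symm,
      C.mem_vertices.2 hv, gate_isHorizontalIsometry (hC v₀ s hv), ?_, ?_, ?_, ?_, ?_, ?_, ?_, ?_,
      ?_, ?_⟩
    · simp [gate]; omega
    · simp [gate]; omega
    · simp [gate]; omega
    · intro v hv hne
      rcases hav v hv hne with h | h
      · left
        simp [Gate.target, gate, Set.insert_subset_iff]; omega
      · right
        simp [Gate.mem_target, gate]; omega
    · rintro (k | x) hi <;> simp [gate, Fin.ext_iff] at hi ⊢ <;> omega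
    · rintro (k | x) hi <;> simp [gate, Fin.ext_iff] at hi ⊢ <;> omega
    · simp [Gate.mem_target, gate]; omega
    · simp [gate]; omega
    · simp [gate]; omega
    · intro v hv hne
      rcases hav v hv hne with h | h
      · left
        simp [Gate.target, gate, Set.insert_subset_iff]; omega
      · right
        simp [Gate.mem_target, gate]; omega

/-- For the other parity the ray descends to the right and ends at `o + t`. `D` exceeds `J` by the
region `o + t + 1 - s`, the right control of the front vertex and thus the left one of its mirror
image. -/
theorem isLightFront_right (hC : C.IsBiunitary) {t : ℕ} {o : Fin (n + 1)}
    (hcone : C.ContainsLightCone o t) (hpar : ¬ Even ((o : ℕ) + t + C.offset)) :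
    Gate.IsLightFront (fun s v => (C.gate s v).mirror) C.vertices C.dims t
      (fun s => sitesWith (fun k => o + t + 2 ≤ k + s) (fun x => o + t + 1 ≤ x + s))
      (fun s => sitesWith (fun k => o + t + 1 ≤ k + s) (fun x => o + t + 1 ≤ x + s)) where
  pos := C.dims_pos
  sub s := sitesWith_subset (fun k h => by omega) fun x h => h
  J_mono s := sitesWith_subset (fun k h => by omega) fun x h => by omega
  D_mono s := sitesWith_subset (fun k h => by omega) fun x h => by omega
  front s hs := by
    obtain ⟨h1, h2, h3⟩ := hcone
    let v₀ : Fin n := ⟨o + t - s - 1, by omega⟩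
    have hv₀ : (v₀ : ℕ) = o + t - s - 1 := rfl
    rw [Nat.even_iff] at hpar
    have hv : C.vertex v₀ s := h3 s hs v₀ (by rw [Nat.even_iff]; omega) (by omega) (by omega)
    have hav : ∀ v ∈ C.vertices s, v ≠ v₀ → (v : ℕ) + 2 ≤ v₀ ∨ (v₀ : ℕ) + 2 ≤ v := by
      intro v hv hne
      have := C.brickwork v s (C.mem_vertices.1 hv)
      have hne' : (v : ℕ) ≠ v₀ := fun e => hne (Fin.ext e)
      rw [Nat.even_iff] at this
      omega
    have hcompat := C.layerCompat s
    have hsep := C.separated s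
    refine ⟨v₀, hsep.mirror, hcompat.mirror,
      fun v hv => (gate_isCoisometry (hC v s (C.mem_vertices.1 hv))).mirror,
      fun v hv => (gate_adjoint_isCoisometry (hC v s (C.mem_vertices.1 hv))
        (hcompat _ fun w hw => hsep.l_notMem hv hw).symm
        (hcompat _ fun w hw => hsep.r_notMem hv hw).symm).mirror,
      C.mem_vertices.2 hv, gate_mirror_isHorizontalIsometry (hC v₀ s hv), ?_, ?_, ?_, ?_, ?_, ?_,
      ?_, ?_, ?_, ?_⟩
    · simp [gate, Gate.mirror]; omega
    · simp [gate, Gate.mirror]; omega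
    · simp [gate, Gate.mirror]; omega
    · intro v hv hne
      rcases hav v hv hne with h | h
      · right
        simp [Gate.mem_target, gate, Gate.mirror]; omega
      · left
        simp [Gate.target, gate, Set.insert_subset_iff, Gate.mirror]; omega
    · rintro (k | x) hi <;> simp [gate, Fin.ext_iff, Gate.mirror] at hi ⊢ <;> omega
    · rintro (k | x) hi <;> simp [gate, Fin.ext_iff, Gate.mirror] at hi ⊢ <;> omega
    · simp [Gate.mem_target, gate, Gate.mirror]; omega
    · simp [gate, Gate.mirror]; omega
    · simp [gate, Gate.mirror]; omega
    · intro v hv hne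
      rcases hav v hv hne with h | h
      · right
        simp [Gate.mem_target, gate, Gate.mirror]; omega
      · left
        simp [Gate.target, gate, Set.insert_subset_iff, Gate.mirror]; omega

end ShadedCircuit

end

theorem mainTheorem1 {n : ℕ} (C : ShadedCircuit n) (hC : C.IsBiunitary)
    (t : ℕ) (o : Fin (n + 1)) (hcone : C.ContainsLightCone o t)
    (x : ℤ) (j : Fin (n + 1)) (hj : (j : ℤ) = (o : ℤ) + x)
    (ρ : Matrix (Fin (C.wireDim o t)) (Fin (C.wireDim o t)) ℂ) (hρ : ρ.trace = 0)
    (σ : Matrix (Fin (C.wireDim j 0)) (Fin (C.wireDim j 0)) ℂ) (hσ : σ.trace = 0)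
    (hx : ¬ (|x| = (t : ℤ) ∨ |x| = (t : ℤ) - 1)) :
    C.correlation t o j ρ σ = 0 := by
  have hx' : x ≠ t ∧ x ≠ -t := by
    refine ⟨fun e => hx (Or.inl ?_), fun e => hx (Or.inl ?_)⟩ <;> simp [e]
  have hto := hcone.1
  refine C.correlation_eq_zero ?_
  by_cases hpar : Even ((o : ℕ) + t + C.offset)
  · have h := ShadedCircuit.isLightFront_left hC hcone hpar
    -- Left of the ray's endpoint the evolved `ρ` is the identity at `j`; right of it `σ` is the
    -- identity on `J 1`, and the forward argument applies.
    rcases lt_or_gt_of_ne (show (j : ℕ) ≠ o - t by omega) with hlt | hgt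
    · refine h.trace_eq_zero_of_mem (Labelling.isLocal_siteOp (d := C.dims t) (.inr o) ρ (h.sub t) ?_) ?_ hσ
      · simp
      · simp; omega
    · refine h.trace_eq_zero_of_isLocal (Labelling.isLocal_siteOp (d := C.dims 0) (.inr j) σ (h.sub 1) ?_) ?_ ?_ hρ
      · simp; omega
      · simp
      · simp
  · have h := ShadedCircuit.isLightFront_right hC hcone hpar
    rw [← Gate.evolutionMat_mirror]
    rcases lt_or_gt_of_ne (show (j : ℕ) ≠ o + t by omega) with hlt | hgt
    · refine h.trace_eq_zero_of_isLocal (Labelling.isLocal_siteOp (d := C.dims 0) (.inr j) σ (h.sub 1) ?_) ?_ ?_ hρ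
      · simp; omega
      · simp
      · simp
    · refine h.trace_eq_zero_of_mem (Labelling.isLocal_siteOp (d := C.dims t) (.inr o) ρ (h.sub t) ?_) ?_ hσ
      · simp
      · simp; omega
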